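/- Let $M$ be a compact smooth manifold without boundary, let $\alpha\in(0,1]$, let $f:M\to M$ be a $C^{1+\alpha}$ diffeomorphism (a $C^1$ diffeomorphism whose derivative is $\alpha$-Hölder), and let $\mu$ be a non-atomic $f$-invariant Borel probability measure on $M$ (not assumed to be smooth). Suppose that $f$ is exponentially mixing with respect to $\mu$, that is, there exist $r\in\mathbb{N}$, $C>0$ and $\eta>0$ such that $$\left|\int_M \phi(x)\,\psi(f^n x)\,d\mu-\int_M\phi\,d\mu\int_M\psi\,d\mu\right|\le C e^{-\eta n}\,\|\phi\|_{r}\,\|\psi\|_{r}$$ for all $\phi,\psi\in C^r(M)$ and all $n\in\mathbb{N}$, where $\|\cdot\|_r$ is the norm on $C^r(M)$. Then $f$ has at least one positive Lyapunov exponent for $\mu$: there is $\chi>0$ such that, for $\mu$-almost every $x\in M$, there is a nonzero vector $v\in T_xM$ with $$\limsup_{n\to\infty}\frac1n\log\|D_xf^n v\|=\chi ,$$ where $\|\cdot\|$ is the norm of any continuous Riemannian metric on $M$. -/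

import Mathlib

open MeasureTheory Filter Topology
open scoped Manifold ContDiff NNReal

noncomputable section

/-- Data from which a norm on `C^r(M)` is built: finitely many charts of the `d`-dimensional
manifold `M` (the preferred charts at the points of `centers`) and compact subsets `piece c` of
their domains which together cover `M`. -/
structure FiniteChartCover (d : ℕ) (M : Type*) [TopologicalSpace M]
    [ChartedSpace (EuclideanSpace ℝ (Fin d)) M] where
  centers : Finset M
  piece : M → Set M
  isCompact_piece : ∀ c ∈ centers, IsCompact (piece c)
  piece_subset : ∀ c ∈ centers, piece c ⊆ (chartAt (EuclideanSpace ℝ (Fin d)) c).source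
  cover : ∀ x : M, ∃ c ∈ centers, x ∈ piece c

/-- The norm of `φ` in `C^r(M)` given by a finite chart cover: the maximum, over the charts of the
cover and the orders `k ≤ r`, of the supremum over the compact piece of the norm of the `k`-th
derivative of `φ` read in the chart. On a compact manifold all choices of the cover give equivalent
norms on `C^r(M)`. -/
def FiniteChartCover.crNorm {d : ℕ} {M : Type*} [TopologicalSpace M]
    [ChartedSpace (EuclideanSpace ℝ (Fin d)) M] (A : FiniteChartCover d M) (r : ℕ) (φ : M → ℝ) :
    ℝ :=
  ⨆ c : A.centers, ⨆ k : Fin (r + 1), ⨆ x : A.piece c,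
    ‖iteratedFDeriv ℝ (k : ℕ) (φ ∘ (chartAt (EuclideanSpace ℝ (Fin d)) (c : M)).symm)
      (chartAt (EuclideanSpace ℝ (Fin d)) (c : M) (x : M))‖

/-- `f` is exponentially mixing with respect to `μ`: for some `r ∈ ℕ`, `C > 0`, `η > 0` and all
`φ, ψ ∈ C^r(M)`, `n ∈ ℕ`,
`|∫ φ · (ψ ∘ fⁿ) dμ - ∫ φ dμ · ∫ ψ dμ| ≤ C e^{-η n} ‖φ‖_r ‖ψ‖_r`.
The finite chart cover `A` only fixes a norm on `C^r(M)`; another one changes only `C`. -/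
def IsExponentiallyMixing (d : ℕ) {M : Type*} [TopologicalSpace M]
    [ChartedSpace (EuclideanSpace ℝ (Fin d)) M] [MeasurableSpace M]
    (f : M → M) (μ : Measure M) : Prop :=
  ∃ (A : FiniteChartCover d M) (r : ℕ) (C η : ℝ), 0 < C ∧ 0 < η ∧
    ∀ φ ψ : M → ℝ, ContMDiff (𝓡 d) 𝓘(ℝ, ℝ) (r : WithTop ℕ∞) φ →
      ContMDiff (𝓡 d) 𝓘(ℝ, ℝ) (r : WithTop ℕ∞) ψ → ∀ n : ℕ,
        |∫ x, φ x * ψ (f^[n] x) ∂μ - (∫ x, φ x ∂μ) * ∫ x, ψ x ∂μ| ≤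
          C * Real.exp (-η * n) * A.crNorm r φ * A.crNorm r ψ

/-- The derivative of `f`, read in charts, is locally `α`-Hölder. On a compact manifold this is the
Hölder condition in the definition of a `C^{1+α}` map. -/
def HasHolderDerivative (d : ℕ) {M : Type*} [TopologicalSpace M]
    [ChartedSpace (EuclideanSpace ℝ (Fin d)) M] (α : ℝ≥0) (f : M → M) : Prop :=
  ∀ x : M, ∃ U ∈ 𝓝 (extChartAt (𝓡 d) x x), ∃ K : ℝ≥0,
    HolderOnWith K α (fderiv ℝ (writtenInExtChartAt (𝓡 d) (𝓡 d) x f)) U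

/-- The (forward) Lyapunov exponent of `f` at `x` in the direction of a nonzero tangent vector `v`,
`limsup_{n → ∞} (1 / n) log ‖D_x fⁿ v‖`, where `‖w‖ = √(g(w, w))` for the Riemannian metric `g`. -/
def lyapunovExponent {d : ℕ} {M : Type*} [TopologicalSpace M]
    [ChartedSpace (EuclideanSpace ℝ (Fin d)) M] [IsManifold (𝓡 d) 1 M]
    (g : Bundle.ContinuousRiemannianMetric (EuclideanSpace ℝ (Fin d))
      (fun x : M => TangentSpace (𝓡 d) x))
    (f : M → M) (x : M) (v : TangentSpace (𝓡 d) x) : EReal :=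
  limsup (fun n : ℕ => (((1 / (n : ℝ)) * Real.log (Real.sqrt (g.inner (f^[n] x)
    (mfderiv (𝓡 d) (𝓡 d) (f^[n]) x v) (mfderiv (𝓡 d) (𝓡 d) (f^[n]) x v))) : ℝ) : EReal)) atTop

end

/-! Embed `M` in some `ℝ^q` and measure distances there, so that `e` is an isometry. The
infinitesimal Lipschitz constant `ptLip f^[n] x` is then comparable to the norm of `D_x fⁿ`, up to
factors independent of `n`, and its growth rate `lipGrowth` can be studied by metric arguments
alone.

Mixing gives ergodicity (`IsExponentiallyMixing.ergodic`), hence `lipGrowth` is almost everywhere a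
constant `χ ≥ 0` (`exists_ae_lipGrowth_eq`). The heart of the matter is that `χ = 0` is impossible
(`not_ae_tendsto_of_correlation_decay`). With zero growth, for every `ε > 0` there is a fixed scale
`ρ` such that, for infinitely many `n` and on a set of measure at least `3/4`, the ball of radius `δ
= ρ e^{-εn}` about `x` is mapped by `fⁿ` into the ball of radius `ρ` about `fⁿ x`
(`exists_small_image_ball`). A bump function on the small ball and a function vanishing on the
`ρ`-ball and equal to `1` off the `2ρ`-ball are then completely uncorrelated at time `n`, in the
sense that the integral of the product is zero. Exponential mixing bounds the product of their
integrals by a constant times `e^{-ηn} δ^{-r} ρ^{-r}`. The second integral is at least `1/2` because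
`μ` has no atoms. A grid count in `ℝ^q` shows that for most `x` the first is at least a constant
times `δ^q`, whatever the measure (`exists_measure_real_ball_lt_le`). For `ε` small compared with `η
/ (q + r)` this fails as `n → ∞`.

Finally, when `χ > 0`, the norm of `D_x fⁿ` is bounded by the sum of its values on a basis. Some
basis vector must therefore realise the full rate `χ` (`exists_lyapunovExponent_eq`), without any
multiplicative ergodic theorem. -/

noncomputable section

/-! ### Local and infinitesimal Lipschitz constants -/

section PointwiseLipschitz

variable {X : Type*} [MetricSpace X]

/-- The Lipschitz constant of `F` at `x` at scale `ρ`. -/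
def localLip (ρ : ℝ) (F : X → X) (x : X) : ℝ :=
  ⨆ z : Metric.ball x ρ, dist (F x) (F z) / dist x z

/-- The infinitesimal Lipschitz constant of `F` at `x`. -/
def ptLip (F : X → X) (x : X) : ℝ := ⨅ n : ℕ, localLip (1 / ((n : ℝ) + 1)) F x

lemma localLip_nonneg (ρ : ℝ) (F : X → X) (x : X) : 0 ≤ localLip ρ F x :=
  Real.iSup_nonneg fun _ => by positivity

lemma ptLip_nonneg (F : X → X) (x : X) : 0 ≤ ptLip F x :=
  Real.iInf_nonneg fun _ => localLip_nonneg _ _ _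

lemma localLip_le {ρ c : ℝ} {F : X → X} {x : X} (hc : 0 ≤ c)
    (h : ∀ z, dist x z < ρ → dist (F x) (F z) ≤ c * dist x z) : localLip ρ F x ≤ c := by
  refine Real.iSup_le (fun z => ?_) hc
  exact div_le_of_le_mul₀ dist_nonneg hc (h z (by rw [dist_comm]; exact z.2))

variable {K : ℝ≥0} {F : X → X}

lemma bddAbove_localLip (hF : LipschitzWith K F) (ρ : ℝ) (x : X) :
    BddAbove (Set.range fun z : Metric.ball x ρ => dist (F x) (F z) / dist x z) := by
  refine ⟨K, ?_⟩
  rintro _ ⟨z, rfl⟩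
  exact div_le_of_le_mul₀ dist_nonneg K.2 (hF.dist_le_mul _ _)

lemma div_le_localLip (hF : LipschitzWith K F) {ρ : ℝ} {x z : X} (h : dist x z < ρ) :
    dist (F x) (F z) / dist x z ≤ localLip ρ F x :=
  le_ciSup (bddAbove_localLip hF ρ x) ⟨z, by simpa [dist_comm] using h⟩

lemma dist_le_localLip_mul (hF : LipschitzWith K F) {ρ : ℝ} {x z : X} (h : dist x z < ρ) :
    dist (F x) (F z) ≤ localLip ρ F x * dist x z := by
  rcases eq_or_ne x z with rfl | hne
  · simp
  · exact (div_le_iff₀ (dist_pos.2 hne)).1 (div_le_localLip hF h)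

lemma localLip_le_lipschitz (hF : LipschitzWith K F) (ρ : ℝ) (x : X) : localLip ρ F x ≤ K :=
  localLip_le K.2 fun z _ => hF.dist_le_mul x z

lemma localLip_mono (hF : LipschitzWith K F) {ρ ρ' : ℝ} (h : ρ ≤ ρ') (x : X) :
    localLip ρ F x ≤ localLip ρ' F x :=
  localLip_le (localLip_nonneg _ _ _) fun _ hz => dist_le_localLip_mul hF (hz.trans_le h)

lemma ptLip_le_localLip (hF : LipschitzWith K F) {ρ : ℝ} (hρ : 0 < ρ) (x : X) :
    ptLip F x ≤ localLip ρ F x := by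
  obtain ⟨n, hn⟩ := exists_nat_one_div_lt hρ
  refine (ciInf_le ⟨0, ?_⟩ n).trans (localLip_mono hF hn.le x)
  rintro _ ⟨k, rfl⟩
  exact localLip_nonneg _ _ _

lemma ptLip_le_lipschitz (hF : LipschitzWith K F) (x : X) : ptLip F x ≤ K :=
  (ptLip_le_localLip hF one_pos x).trans (localLip_le_lipschitz hF 1 x)

lemma ptLip_le_of_eventually (hF : LipschitzWith K F) {c : ℝ} {x : X} (hc : 0 ≤ c)
    (h : ∀ᶠ z in 𝓝 x, dist (F x) (F z) ≤ c * dist x z) : ptLip F x ≤ c := by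
  obtain ⟨ρ, hρ, H⟩ := Metric.eventually_nhds_iff.1 h
  exact (ptLip_le_localLip hF hρ x).trans
    (localLip_le hc fun z hz => H (by rwa [dist_comm]))

lemma eventually_dist_le_of_ptLip_lt (hF : LipschitzWith K F) {c : ℝ} {x : X}
    (h : ptLip F x < c) : ∀ᶠ z in 𝓝 x, dist (F x) (F z) ≤ c * dist x z := by
  obtain ⟨n, hn⟩ := exists_lt_of_ciInf_lt h
  refine Metric.eventually_nhds_iff.2 ⟨1 / ((n : ℝ) + 1), by positivity, fun z hz => ?_⟩
  refine (dist_le_localLip_mul hF (by rwa [dist_comm])).trans ?_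
  gcongr

lemma tendsto_localLip (hF : LipschitzWith K F) (x : X) :
    Tendsto (fun n : ℕ => localLip (1 / ((n : ℝ) + 1)) F x) atTop (𝓝 (ptLip F x)) := by
  refine tendsto_atTop_ciInf (fun m n hmn => localLip_mono hF ?_ x) ⟨0, ?_⟩
  · exact one_div_le_one_div_of_le (by positivity) (by gcongr)
  · rintro _ ⟨k, rfl⟩
    exact localLip_nonneg _ _ _

/-- A point `z` whose quotient at `x` exceeds `c` stays in the ball about any nearby `y`, and its
quotient varies continuously. The lemma serves the measurability of `localLip`, and of `ptLip` as a
pointwise limit. -/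
lemma lowerSemicontinuous_localLip (hF : LipschitzWith K F) (ρ : ℝ) :
    LowerSemicontinuous (localLip ρ F) := by
  intro x c hc
  rcases lt_or_ge c 0 with h0 | h0
  · exact Eventually.of_forall fun y => h0.trans_le (localLip_nonneg _ _ _)
  -- A supremum over an empty ball is `0` by convention, and so is a quotient with denominator `0`.
  -- Neither can exceed `c ≥ 0`.
  have : Nonempty (Metric.ball x ρ) := by
    by_contra hne
    rw [not_nonempty_iff] at hne
    rw [localLip, Real.iSup_of_isEmpty] at hc
    exact absurd hc (not_lt.2 h0)
  obtain ⟨z, hz⟩ := exists_lt_of_lt_ciSup hc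
  have hxz : dist x (z : X) ≠ 0 := by
    intro h
    rw [h, div_zero] at hz
    exact absurd hz (not_lt.2 h0)
  have h1 : ContinuousAt (fun y => dist (F y) (F z) / dist y z) x :=
    ((hF.continuous.continuousAt.dist continuousAt_const)).div
      (continuousAt_id.dist continuousAt_const) hxz
  have h2 : ∀ᶠ y in 𝓝 x, dist y (z : X) < ρ :=
    (continuousAt_id.dist continuousAt_const).eventually_lt continuousAt_const
      (by rw [dist_comm]; exact z.2)
  filter_upwards [h1.eventually_const_lt hz, h2] with y hy hy2
  exact hy.trans_le (div_le_localLip hF hy2)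

variable [MeasurableSpace X] [BorelSpace X]

lemma measurable_localLip (hF : LipschitzWith K F) (ρ : ℝ) : Measurable (localLip ρ F) :=
  (lowerSemicontinuous_localLip hF ρ).measurable

lemma measurable_ptLip (hF : LipschitzWith K F) : Measurable (ptLip F) :=
  measurable_of_tendsto_metrizable (fun _ => measurable_localLip hF _)
    (tendsto_pi_nhds.2 fun x => tendsto_localLip hF x)

omit [MeasurableSpace X] [BorelSpace X] in
-- One half of a chain rule. The crude global constant of the inner map suffices, because it is used
-- for a single application of `f`, whose cost is negligible after division by `n`.
lemma ptLip_comp_le {K' : ℝ≥0} {G : X → X} (hG : LipschitzWith K' G) (hF : LipschitzWith K F)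
    (x : X) : ptLip (G ∘ F) x ≤ ptLip G (F x) * K := by
  have key : ∀ c, ptLip G (F x) < c → ptLip (G ∘ F) x ≤ c * K := by
    intro c hc
    have hc0 : 0 ≤ c := (ptLip_nonneg _ _).trans hc.le
    refine ptLip_le_of_eventually (hG.comp hF) (by positivity) ?_
    filter_upwards [hF.continuous.continuousAt.eventually
      (eventually_dist_le_of_ptLip_lt hG hc)] with z hz
    calc dist (G (F x)) (G (F z)) ≤ c * dist (F x) (F z) := hz
      _ ≤ c * (K * dist x z) := by gcongr; exact hF.dist_le_mul _ _
      _ = c * K * dist x z := by ring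
  have ht : Tendsto (fun c : ℝ => c * K) (𝓝[>] (ptLip G (F x))) (𝓝 (ptLip G (F x) * K)) :=
    ((continuous_id.mul continuous_const).tendsto _).mono_left nhdsWithin_le_nhds
  exact ge_of_tendsto ht (eventually_mem_nhdsWithin.mono fun c hc => key c hc)

end PointwiseLipschitz

/-! ### Subexponential growth keeps exponentially small balls small -/

section Growth

open Real

variable {X : Type*} [MetricSpace X] [MeasurableSpace X] [BorelSpace X]
  {μ : Measure X} [IsProbabilityMeasure μ] {K : ℝ≥0} {f : X → X}

omit [MeasurableSpace X] [BorelSpace X] in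
-- While two orbits are within `ρ`, one application of `f^[N]` expands their distance by at most
-- `max 1 (localLip ρ ...)`. Using `log⁺` makes the partial sums increase, so the bound `s` on the
-- whole sum controls every intermediate time and the orbits never separate beyond `ρ`.
lemma dist_iterate_le {N : ℕ} {ρ s : ℝ} {K : ℝ≥0} (hF : LipschitzWith K f^[N]) {m : ℕ} {x y : X}
    (hs : ∑ j ∈ Finset.range m, log⁺ (localLip ρ f^[N] (f^[N * j] x)) ≤ s)
    (hxy : dist x y < ρ * exp (-s)) : dist (f^[N * m] x) (f^[N * m] y) < ρ := by
  have hρ : 0 < ρ := by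
    by_contra! h
    exact absurd (dist_nonneg.trans_lt hxy) (not_lt.2 (mul_nonpos_of_nonpos_of_nonneg h (exp_pos _).le))
  set P : ℕ → ℝ := fun j => log⁺ (localLip ρ f^[N] (f^[N * j] x)) with hP
  have hle : ∀ j ≤ m, ∑ i ∈ Finset.range j, P i ≤ s := fun j hj =>
    (Finset.sum_le_sum_of_subset_of_nonneg (Finset.range_mono hj)
      fun _ _ _ => posLog_nonneg).trans hs
  have hlt : ∀ j ≤ m, exp (∑ i ∈ Finset.range j, P i) * dist x y < ρ := by
    intro j hj
    calc exp (∑ i ∈ Finset.range j, P i) * dist x y ≤ exp s * dist x y := by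
          gcongr; exact hle j hj
      _ < exp s * (ρ * exp (-s)) := by gcongr
      _ = ρ := by rw [mul_left_comm, ← exp_add]; simp
  have key : ∀ j ≤ m, dist (f^[N * j] x) (f^[N * j] y) ≤
      exp (∑ i ∈ Finset.range j, P i) * dist x y := by
    intro j
    induction j with
    | zero => intro _; simp
    | succ j ih =>
      intro hj
      have h1 := ih (by omega)
      have h2 := h1.trans_lt (hlt j (by omega))
      have h3 := dist_le_localLip_mul hF h2
      have e1 : ∀ z, f^[N * (j + 1)] z = f^[N] (f^[N * j] z) := fun z => by
        rw [← Function.iterate_add_apply]; congr 2; ring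
      rw [e1, e1, Finset.sum_range_succ, exp_add]
      have h4 : localLip ρ f^[N] (f^[N * j] x) ≤ exp (P j) := by
        simp only [hP]
        rw [posLog_eq_log_max_one (localLip_nonneg _ _ _), exp_log (by positivity)]
        exact le_max_right _ _
      calc _ ≤ _ := h3
        _ ≤ exp (P j) * (exp (∑ i ∈ Finset.range j, P i) * dist x y) := by gcongr
        _ = _ := by ring
  exact (key m le_rfl).trans_lt (hlt m le_rfl)

omit [MetricSpace X] [BorelSpace X] in
lemma integrable_posLog_of_le {h : X → ℝ} (hm : Measurable h) (h0 : ∀ x, 0 ≤ h x) {K : ℝ}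
    (hK : ∀ x, h x ≤ K) : Integrable (fun x => log⁺ (h x)) μ := by
  refine Integrable.of_bound (C := log⁺ K)
    (continuous_posLog.measurable.comp hm).aestronglyMeasurable
    (Eventually.of_forall fun x => ?_)
  rw [norm_of_nonneg posLog_nonneg]
  exact posLog_le_posLog (h0 x) (hK x)

/-- Dominated convergence twice: in `n`, with dominating constant `log⁺ K`, to choose `N`; then, for
this `N`, as the scale tends to `0`, to pass from `ptLip` to `localLip` at a positive scale. -/
lemma exists_integral_posLog_localLip_le (hf : LipschitzWith K f)
    (h : ∀ᵐ x ∂μ, Tendsto (fun n : ℕ => 1 / (n : ℝ) * log⁺ (ptLip f^[n] x)) atTop (𝓝 0))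
    {ε ρ₁ : ℝ} (hε : 0 < ε) (hρ₁ : 0 < ρ₁) :
    ∃ N : ℕ, 0 < N ∧ ∃ ρ, 0 < ρ ∧ ρ ≤ ρ₁ ∧ ∫ x, log⁺ (localLip ρ f^[N] x) ∂μ ≤ ε * N := by
  have h1 : Tendsto (fun n : ℕ => ∫ x, 1 / (n : ℝ) * log⁺ (ptLip f^[n] x) ∂μ) atTop (𝓝 0) := by
    have := tendsto_integral_of_dominated_convergence (μ := μ)
      (F := fun n : ℕ => fun x => 1 / (n : ℝ) * log⁺ (ptLip f^[n] x)) (f := fun _ => (0 : ℝ))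
      (fun _ => log⁺ (K : ℝ)) (fun n => ?_) (integrable_const _) (fun n => ?_) h
    · simpa using this
    · exact (measurable_const.mul (continuous_posLog.measurable.comp
        (measurable_ptLip (hf.iterate n)))).aestronglyMeasurable
    · refine Eventually.of_forall fun x => ?_
      rw [norm_of_nonneg (mul_nonneg (by positivity) posLog_nonneg)]
      rcases Nat.eq_zero_or_pos n with rfl | hn
      · simpa using posLog_nonneg
      have hn' : (0 : ℝ) < n := by exact_mod_cast hn
      have := posLog_le_posLog (ptLip_nonneg _ _) (ptLip_le_lipschitz (hf.iterate n) x)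
      rw [NNReal.coe_pow, posLog_pow] at this
      rw [one_div, inv_mul_le_iff₀ hn']
      exact this
  obtain ⟨N, hN, hN0⟩ := ((h1.eventually_lt_const hε).and (eventually_gt_atTop 0)).exists
  have hN' : (0 : ℝ) < N := by exact_mod_cast hN0
  refine ⟨N, hN0, ?_⟩
  have hL := hf.iterate N
  have h2 : Tendsto (fun k : ℕ => ∫ x, log⁺ (localLip (1 / ((k : ℝ) + 1)) f^[N] x) ∂μ) atTop
      (𝓝 (∫ x, log⁺ (ptLip f^[N] x) ∂μ)) := by
    refine tendsto_integral_of_dominated_convergence (fun _ => log⁺ ((K ^ N : ℝ≥0) : ℝ))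
      (fun k => ?_) (integrable_const _) (fun k => ?_) ?_
    · exact (continuous_posLog.measurable.comp (measurable_localLip hL _)).aestronglyMeasurable
    · refine Eventually.of_forall fun x => ?_
      rw [norm_of_nonneg posLog_nonneg]
      exact posLog_le_posLog (localLip_nonneg _ _ _) (localLip_le_lipschitz hL _ _)
    · exact Eventually.of_forall fun x =>
        (continuous_posLog.tendsto _).comp (tendsto_localLip hL x)
  have h3 : ∫ x, log⁺ (ptLip f^[N] x) ∂μ < ε * N := by
    rw [integral_const_mul, one_div, inv_mul_lt_iff₀ hN'] at hN
    linarith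
  have h4 : Tendsto (fun k : ℕ => 1 / ((k : ℝ) + 1)) atTop (𝓝 0) :=
    tendsto_one_div_add_atTop_nhds_zero_nat
  obtain ⟨k, hk, hk'⟩ := ((h2.eventually_lt_const h3).and (h4.eventually_lt_const hρ₁)).exists
  exact ⟨_, by positivity, hk'.le, hk.le⟩

/-- If the infinitesimal Lipschitz constants of the iterates grow subexponentially almost
everywhere, then with large probability exponentially small balls stay small. -/
lemma exists_small_image_ball (hf : LipschitzWith K f) (hμ : MeasurePreserving f μ μ)
    (h : ∀ᵐ x ∂μ, Tendsto (fun n : ℕ => 1 / (n : ℝ) * log⁺ (ptLip f^[n] x)) atTop (𝓝 0))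
    {ε ρ₁ : ℝ} (hε : 0 < ε) (hρ₁ : 0 < ρ₁) :
    ∃ N : ℕ, 0 < N ∧ ∃ ρ, 0 < ρ ∧ ρ ≤ ρ₁ ∧ ∀ m : ℕ, 0 < m → ∃ B : Set X, μ.real B ≤ 1 / 4 ∧
      ∀ x ∉ B, ∀ y, dist x y < ρ * exp (-(ε * (N * m : ℕ))) →
        dist (f^[N * m] x) (f^[N * m] y) < ρ := by
  -- By invariance the sum of `m` terms along the orbit has integral at most `m * (ε / 4 * N)`, so
  -- Markov's inequality at level `ε * N * m` yields the bound `1 / 4`.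
  obtain ⟨N, hN, ρ, hρ, hρ', hint⟩ :=
    exists_integral_posLog_localLip_le hf h (ε := ε / 4) (by positivity) hρ₁
  refine ⟨N, hN, ρ, hρ, hρ', fun m hm => ?_⟩
  have hL := hf.iterate N
  set P : X → ℝ := fun x => log⁺ (localLip ρ f^[N] x) with hP
  have hPi : Integrable P μ := integrable_posLog_of_le (measurable_localLip hL ρ)
    (localLip_nonneg _ _) (localLip_le_lipschitz hL ρ)
  have hPj : ∀ j : ℕ, Integrable (fun x => P (f^[N * j] x)) μ := fun j =>
    (hμ.iterate (N * j)).integrable_comp_of_integrable hPi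
  have hPint : ∀ j : ℕ, ∫ x, P (f^[N * j] x) ∂μ = ∫ x, P x ∂μ := fun j => by
    have hp := hμ.iterate (N * j)
    conv_rhs => rw [← hp.map_eq]
    rw [integral_map hp.aemeasurable]
    rw [hp.map_eq]
    exact hPi.aestronglyMeasurable
  have hN' : (0 : ℝ) < N := by exact_mod_cast hN
  have hm' : (0 : ℝ) < m := by exact_mod_cast hm
  refine ⟨{x | ε * (N * m : ℕ) ≤ ∑ j ∈ Finset.range m, P (f^[N * j] x)}, ?_, fun x hx y hy => ?_⟩
  · have := mul_meas_ge_le_integral_of_nonneg (μ := μ)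
      (f := fun x => ∑ j ∈ Finset.range m, P (f^[N * j] x))
      (Eventually.of_forall fun x => Finset.sum_nonneg fun _ _ => posLog_nonneg)
      (integrable_finsetSum _ fun j _ => hPj j) (ε * (N * m : ℕ))
    rw [integral_finsetSum _ fun j _ => hPj j] at this
    simp only [hPint, Finset.sum_const, Finset.card_range, nsmul_eq_mul] at this
    have h2 : (m : ℝ) * ∫ x, P x ∂μ ≤ ε * (N * m : ℕ) * (1 / 4) := by
      push_cast
      calc (m : ℝ) * ∫ x, P x ∂μ ≤ m * (ε / 4 * N) := by gcongr
        _ = _ := by ring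
    have h3 : 0 < ε * (N * m : ℕ) := by push_cast; positivity
    exact le_of_mul_le_mul_left (this.trans h2) h3
  · simp only [Set.mem_ofPred_eq, not_le] at hx
    exact dist_iterate_le hL hx.le hy

end Growth

/-! ### Masses of balls and the contradiction with zero growth -/

section Mass

variable {X : Type*} [MetricSpace X] [CompactSpace X] [MeasurableSpace X] [BorelSpace X]
  {μ : Measure X} [IsProbabilityMeasure μ]

/-- Closed balls about `x` decrease to `{x}`, which is null. A Lebesgue number of the resulting
cover makes the radius uniform. -/
lemma exists_forall_measure_ball_le_half (hna : ∀ x : X, μ {x} = 0) :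
    ∃ ρ > 0, ∀ p : X, μ.real (Metric.ball p ρ) ≤ 1 / 2 := by
  have h1 : ∀ x : X, ∃ r > 0, μ (Metric.ball x r) ≤ 1 / 2 := by
    intro x
    have ht : Tendsto (fun r => μ (Metric.closedBall x r)) (𝓝[>] 0) (𝓝 (μ {x})) := by
      have := tendsto_measure_biInter_gt (μ := μ) (s := fun r => Metric.closedBall x r) (a := (0 : ℝ))
        (fun _ _ => Metric.isClosed_closedBall.nullMeasurableSet)
        (fun i j _ hij => Metric.closedBall_subset_closedBall hij)
        ⟨1, one_pos, measure_ne_top _ _⟩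
      have hset : {x} = ⋂ r, ⋂ (_ : r > (0 : ℝ)), Metric.closedBall x r := by
        ext y
        simp only [Set.mem_singleton_iff, gt_iff_lt, Set.mem_iInter, Metric.mem_closedBall]
        constructor
        · rintro rfl i hi; simpa using hi.le
        · intro h
          exact dist_le_zero.1 (le_of_forall_gt_imp_ge_of_dense h)
      rw [hset]
      exact this
    rw [hna x] at ht
    obtain ⟨r, hr, hr0⟩ := ((ht.eventually_lt_const
      (show (0 : ENNReal) < 1 / 2 by simp)).and eventually_mem_nhdsWithin).exists
    exact ⟨r, hr0, (measure_mono Metric.ball_subset_closedBall).trans hr.le⟩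
  choose r hr hμr using h1
  obtain ⟨ρ, hρ, H⟩ := lebesgue_number_lemma_of_metric (s := (Set.univ : Set X)) isCompact_univ
    (c := fun x => Metric.ball x (r x)) (fun x => Metric.isOpen_ball)
    (fun x _ => Set.mem_iUnion.2 ⟨x, Metric.mem_ball_self (hr x)⟩)
  refine ⟨ρ, hρ, fun p => ?_⟩
  obtain ⟨x, hx⟩ := H p trivial
  have := ENNReal.toReal_mono (by simp) ((measure_mono hx).trans (hμr x))
  simpa [Measure.real] using this

/-- Cut the ambient space into cubes of diameter less than `δ`. The ball about a point contains the
part of `X` in its cube, so a ball of small mass forces a cube of small mass; there are `O(δ ^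
(-q))` cubes, so the light ones carry little mass in total. -/
lemma exists_measure_real_ball_lt_le {q : ℕ} {e : X → EuclideanSpace ℝ (Fin q)}
    (he : Isometry e) : ∃ c > 0, ∀ δ, 0 < δ → δ ≤ 1 →
      μ.real {x | μ.real (Metric.ball x δ) < c * δ ^ q} ≤ 1 / 4 := by
  obtain ⟨R, hR⟩ : ∃ R : ℝ, ∀ x, ‖e x‖ ≤ R := by
    obtain ⟨R, hR⟩ := (isCompact_range he.continuous).isBounded.exists_norm_le
    exact ⟨R, fun x => hR _ ⟨x, rfl⟩⟩
  set R' := max R 0 with hR'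
  have hR0 : 0 ≤ R' := le_max_right _ _
  have hRR : ∀ x, ‖e x‖ ≤ R' := fun x => (hR x).trans (le_max_left _ _)
  -- Each coordinate meets at most `2 * b + 1` intervals, where `b < R' * (q + 1) / δ + 1`. As `δ ≤
  -- 1`, this is at most `B / δ`; the factor `1 / (4 * B ^ q)` then makes the total `1 / 4`.
  set B : ℝ := 2 * R' * (q + 1) + 3 with hB
  have hB0 : 0 < B := by positivity
  refine ⟨1 / (4 * B ^ q), by positivity, fun δ hδ hδ1 => ?_⟩
  -- Two points in a cube of side `s` are at distance at most `√q * s`, which is less than `(q + 1)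
  -- * s = δ`.
  set s : ℝ := δ / (q + 1) with hs
  have hs0 : 0 < s := by positivity
  set cell : X → (Fin q → ℤ) := fun x i => ⌊e x i / s⌋ with hcell
  set b : ℤ := ⌈R' / s⌉ with hb
  have hb0 : 0 ≤ b := Int.ceil_nonneg (by positivity)
  set I : Finset (Fin q → ℤ) := Fintype.piFinset fun _ => Finset.Icc (-b) b with hI
  set θ : ℝ := 1 / (4 * B ^ q) * δ ^ q with hθ
  have hmem : ∀ x, cell x ∈ I := by
    intro x
    rw [hI, Fintype.mem_piFinset]
    intro i
    have hxi : |e x i| ≤ R' := by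
      have := PiLp.norm_apply_le (e x) i
      rw [Real.norm_eq_abs] at this
      exact this.trans (hRR x)
    rw [abs_le] at hxi
    rw [Finset.mem_Icc, hcell]
    constructor
    · rw [Int.le_floor]
      push_cast
      rw [le_div_iff₀ hs0]
      have : R' ≤ b * s := (div_le_iff₀ hs0).1 (Int.le_ceil _)
      linarith
    · rw [Int.floor_le_iff]
      have : R' / s ≤ b := Int.le_ceil _
      have h2 : e x i / s ≤ R' / s := by gcongr; exact hxi.2
      linarith
  have hdist : ∀ x y, cell x = cell y → dist x y < δ := by
    intro x y hxy
    rw [← he.dist_eq, EuclideanSpace.dist_eq]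
    have h1 : ∀ i, dist (e x i) (e y i) ^ 2 ≤ s ^ 2 := by
      intro i
      have h2 : ⌊e x i / s⌋ = ⌊e y i / s⌋ := congrFun hxy i
      have h3 := Int.abs_sub_lt_one_of_floor_eq_floor h2
      rw [← sub_div, abs_div, abs_of_pos hs0, div_lt_one hs0] at h3
      rw [Real.dist_eq]
      gcongr
    have h4 : ∑ i, dist (e x i) (e y i) ^ 2 ≤ q * s ^ 2 := by
      refine (Finset.sum_le_sum fun i _ => h1 i).trans ?_
      simp
    rw [Real.sqrt_lt' hδ]
    have h5 : δ = s * (q + 1) := by rw [hs]; field_simp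
    rw [h5]
    have : (0 : ℝ) ≤ q := by positivity
    have h6 : 0 < s ^ 2 := by positivity
    nlinarith
  have hcard : (I.card : ℝ) ≤ (B / δ) ^ q := by
    rw [hI, Fintype.card_piFinset]
    simp only [Int.card_Icc, Finset.prod_const, Finset.card_univ, Fintype.card_fin]
    push_cast
    gcongr
    have h1 : ((b + 1 - -b).toNat : ℝ) = 2 * b + 1 := by
      have : ((b + 1 - -b).toNat : ℤ) = 2 * b + 1 := by omega
      exact_mod_cast this
    rw [h1]
    have h2 : (b : ℝ) < R' / s + 1 := Int.ceil_lt_add_one _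
    have h3 : R' / s = R' * (q + 1) / δ := by rw [hs]; field_simp
    rw [le_div_iff₀ hδ]
    rw [h3] at h2
    have h4 : (b : ℝ) * δ ≤ R' * (q + 1) + δ := by
      have := mul_le_mul_of_nonneg_right h2.le hδ.le
      rwa [add_mul, one_mul, div_mul_cancel₀ _ hδ.ne'] at this
    rw [hB]
    nlinarith
  have hsub : {x | μ.real (Metric.ball x δ) < θ} ⊆
      ⋃ k ∈ I.filter (fun k => μ.real (cell ⁻¹' {k}) ≤ θ), cell ⁻¹' {k} := by
    intro x hx
    simp only [Set.mem_iUnion]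
    refine ⟨cell x, ?_, rfl⟩
    rw [Finset.mem_filter]
    refine ⟨hmem x, le_trans (measureReal_mono ?_) (le_of_lt hx)⟩
    intro y hy
    exact hdist y x hy
  have hθ0 : 0 ≤ θ := by positivity
  calc μ.real {x | μ.real (Metric.ball x δ) < θ}
      ≤ μ.real (⋃ k ∈ I.filter (fun k => μ.real (cell ⁻¹' {k}) ≤ θ), cell ⁻¹' {k}) :=
        measureReal_mono hsub (measure_ne_top _ _)
    _ ≤ ∑ k ∈ I.filter (fun k => μ.real (cell ⁻¹' {k}) ≤ θ), μ.real (cell ⁻¹' {k}) :=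
        measureReal_biUnion_finset_le _ _
    _ ≤ ∑ k ∈ I.filter (fun k => μ.real (cell ⁻¹' {k}) ≤ θ), θ :=
        Finset.sum_le_sum fun k hk => (Finset.mem_filter.1 hk).2
    _ ≤ I.card * θ := by
        rw [Finset.sum_const, nsmul_eq_mul]
        gcongr
        exact Finset.filter_subset _ _
    _ ≤ (B / δ) ^ q * θ := by gcongr
    _ = 1 / 4 := by rw [hθ, div_pow]; field_simp

/-- Exponential decay of correlations between balls, for a non-atomic measure on a subset of a
Euclidean space, rules out subexponential growth of the infinitesimal Lipschitz constants. -/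
lemma not_ae_tendsto_of_correlation_decay {K : ℝ≥0} {f : X → X} {q : ℕ}
    {e : X → EuclideanSpace ℝ (Fin q)} (he : Isometry e) (hna : ∀ x : X, μ {x} = 0)
    (hf : LipschitzWith K f) (hμ : MeasurePreserving f μ μ) {r : ℕ} {C η : ℝ} (hη : 0 < η)
    (hmix : ∀ (x y : X) (δ ρ : ℝ) (n : ℕ), 0 < δ → δ ≤ 1 → 0 < ρ → ρ ≤ 1 →
      (∀ z, dist x z < δ → dist y (f^[n] z) < ρ) →
      μ.real (Metric.ball x (δ / 2)) * μ.real (Metric.ball y (2 * ρ))ᶜ ≤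
        C * Real.exp (-η * n) * δ⁻¹ ^ r * ρ⁻¹ ^ r) :
    ¬ ∀ᵐ x ∂μ, Tendsto (fun n : ℕ => 1 / (n : ℝ) * Real.posLog (ptLip f^[n] x)) atTop (𝓝 0) := by
  intro h
  obtain ⟨ρ₀, hρ₀, hhalf⟩ := exists_forall_measure_ball_le_half hna
  obtain ⟨c, hc, hmass⟩ := exists_measure_real_ball_lt_le (μ := μ) he
  -- Chosen so that `ε * (q + r) ≤ η / 2`: the loss `δ ^ (q + r)` consumes at most half of the
  -- mixing rate. The extra `1` keeps the denominator positive when `q = r = 0`.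
  set ε := η / (2 * (q + r + 1)) with hε
  have hε0 : 0 < ε := by positivity
  obtain ⟨N, hN, ρ, hρ, hρ', H⟩ := exists_small_image_ball hf hμ h hε0
    (ρ₁ := min 1 (ρ₀ / 2)) (by positivity)
  have hρ1 : ρ ≤ 1 := hρ'.trans (min_le_left _ _)
  have hρ2 : 2 * ρ ≤ ρ₀ := by linarith [hρ'.trans (min_le_right _ _)]
  -- `N` and `ρ` are fixed before `m`, so the left side is a positive constant while the right side
  -- tends to `0` as `m → ∞`.
  have key : ∀ m : ℕ, 0 < m → c / 2 ^ q * (1 / 2) * ρ ^ (q + r + r) ≤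
      C * Real.exp (-(η / 2) * (N * m : ℕ)) := by
    intro m hm
    obtain ⟨B, hB, HB⟩ := H m hm
    set n := N * m with hn
    set δ := ρ * Real.exp (-(ε * n)) with hδ
    have hδ0 : 0 < δ := by positivity
    have hδ1 : δ ≤ 1 := by
      have : Real.exp (-(ε * n)) ≤ 1 := Real.exp_le_one_iff.2 (by
        have : 0 ≤ ε * n := by positivity
        linarith)
      calc δ ≤ 1 * 1 := mul_le_mul hρ1 this (Real.exp_pos _).le zero_le_one
        _ = 1 := by ring
    have hB' := hmass (δ / 2) (by positivity) (by linarith)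
    -- The two exceptional sets have measure at most `1 / 4` each and cannot cover the space.
    obtain ⟨x, hx⟩ : ∃ x, x ∉ B ∪ {x | μ.real (Metric.ball x (δ / 2)) < c * (δ / 2) ^ q} := by
      by_contra! hall
      have : μ.real Set.univ ≤ 1 / 4 + 1 / 4 :=
        (measureReal_mono (fun x _ => hall x)).trans
          ((measureReal_union_le _ _).trans (add_le_add hB hB'))
      rw [probReal_univ] at this
      norm_num at this
    simp only [Set.mem_union, Set.mem_ofPred_eq, not_or, not_lt] at hx
    have h1 := hmix x (f^[n] x) δ ρ n hδ0 hδ1 hρ hρ1 (fun z hz => HB x hx.1 z hz)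
    have h2 : 1 / 2 ≤ μ.real (Metric.ball (f^[n] x) (2 * ρ))ᶜ := by
      rw [probReal_compl_eq_one_sub Metric.isOpen_ball.measurableSet]
      have := (measureReal_mono (μ := μ) (Metric.ball_subset_ball hρ2)).trans (hhalf (f^[n] x))
      linarith
    have h3 : c * (δ / 2) ^ q * (1 / 2) ≤ C * Real.exp (-η * n) * δ⁻¹ ^ r * ρ⁻¹ ^ r :=
      le_trans (mul_le_mul hx.2 h2 (by norm_num) measureReal_nonneg) h1
    have h4 : c / 2 ^ q * (1 / 2) * δ ^ (q + r) * ρ ^ r ≤ C * Real.exp (-η * n) := by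
      have := mul_le_mul_of_nonneg_right h3 (show 0 ≤ δ ^ r * ρ ^ r by positivity)
      calc _ = c * (δ / 2) ^ q * (1 / 2) * (δ ^ r * ρ ^ r) := by rw [div_pow, pow_add]; ring
        _ ≤ _ := this
        _ = C * Real.exp (-η * n) * ((δ⁻¹ * δ) ^ r * (ρ⁻¹ * ρ) ^ r) := by
          rw [mul_pow, mul_pow]; ring
        _ = _ := by rw [inv_mul_cancel₀ hδ0.ne', inv_mul_cancel₀ hρ.ne']; simp
    have h5 : δ ^ (q + r) = ρ ^ (q + r) * Real.exp (-(ε * (q + r) * n)) := by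
      rw [hδ, mul_pow, ← Real.exp_nat_mul]
      congr 2
      push_cast
      ring
    have h6 : ε * (q + r) ≤ η / 2 := by
      rw [hε, div_mul_eq_mul_div, div_le_iff₀ (by positivity)]
      nlinarith
    have h7 : Real.exp (-(η / 2 * n)) ≤ Real.exp (-(ε * (q + r) * n)) := by
      apply Real.exp_le_exp.2
      have : ε * (q + r) * n ≤ η / 2 * n := by gcongr
      linarith
    have h8 : c / 2 ^ q * (1 / 2) * ρ ^ (q + r + r) * Real.exp (-(η / 2 * n)) ≤
        C * Real.exp (-η * n) := by
      refine le_trans ?_ h4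
      rw [h5, pow_add ρ (q + r)]
      calc _ ≤ c / 2 ^ q * (1 / 2) * (ρ ^ (q + r) * ρ ^ r) * Real.exp (-(ε * (q + r) * n)) := by
            gcongr
        _ = _ := by ring
    have h9 : Real.exp (-η * n) = Real.exp (-(η / 2) * n) * Real.exp (-(η / 2 * n)) := by
      rw [← Real.exp_add]; congr 1; ring
    rw [h9, ← mul_assoc] at h8
    exact le_of_mul_le_mul_right h8 (Real.exp_pos _)
  have hlim : Tendsto (fun m : ℕ => C * Real.exp (-(η / 2) * (N * m : ℕ))) atTop (𝓝 (C * 0)) := by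
    refine Tendsto.const_mul _ (Real.tendsto_exp_atBot.comp ?_)
    refine Tendsto.const_mul_atTop_of_neg (by linarith) (tendsto_natCast_atTop_atTop.comp ?_)
    exact tendsto_id.const_mul_atTop' hN
  rw [mul_zero] at hlim
  have h0 : 0 < c / 2 ^ q * (1 / 2) * ρ ^ (q + r + r) := by positivity
  exact absurd (ge_of_tendsto hlim ((eventually_gt_atTop 0).mono fun m hm => key m hm))
    (not_le.2 h0)

end Mass

/-! ### `C^r` norms of rescaled test functions -/

lemma exists_bound_iteratedFDeriv_of_hasCompactSupport {E : Type*} [NormedAddCommGroup E]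
    [NormedSpace ℝ E] {b : E → ℝ} (hb : ContDiff ℝ ∞ b) (hs : HasCompactSupport b) (r : ℕ) :
    ∃ C : ℝ, 0 ≤ C ∧ ∀ i ≤ r, ∀ v, ‖iteratedFDeriv ℝ i b v‖ ≤ C := by
  have h1 : ∀ i : ℕ, ∃ C, ∀ v, ‖iteratedFDeriv ℝ i b v‖ ≤ C := fun i =>
    (hs.iteratedFDeriv i).exists_bound_of_continuous
      (hb.continuous_iteratedFDeriv (by exact_mod_cast le_top))
  choose C hC using h1
  refine ⟨∑ i ∈ Finset.range (r + 1), |C i|, by positivity, fun i hi v => ?_⟩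
  refine ((hC i v).trans (le_abs_self _)).trans ?_
  exact Finset.single_le_sum (f := fun i => |C i|) (fun _ _ => abs_nonneg _)
    (Finset.mem_range.2 (by omega))

section TestFunctions

variable {d : ℕ} {M : Type*} [TopologicalSpace M] [ChartedSpace (EuclideanSpace ℝ (Fin d)) M]
  [IsManifold (𝓡 d) ∞ M] {q : ℕ} {e : M → EuclideanSpace ℝ (Fin q)}

lemma contDiffOn_comp_chartAt_symm
    (he : ContMDiff (𝓡 d) 𝓘(ℝ, EuclideanSpace ℝ (Fin q)) ∞ e) (c : M) :
    ContDiffOn ℝ ∞ (e ∘ (chartAt (EuclideanSpace ℝ (Fin d)) c).symm)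
      (chartAt (EuclideanSpace ℝ (Fin d)) c).target := by
  rw [← contMDiffOn_iff_contDiffOn]
  exact he.comp_contMDiffOn (contMDiffOn_chart_symm (I := 𝓡 d) (n := ∞) (x := c))

/-- Continuity on the compact pieces gives the bound. The normalisation `1 ≤ D` ensures later that
`δ⁻¹ * D` is bounded by its own positive powers. -/
lemma FiniteChartCover.exists_bound_iteratedFDerivWithin (A : FiniteChartCover d M)
    (he : ContMDiff (𝓡 d) 𝓘(ℝ, EuclideanSpace ℝ (Fin q)) ∞ e)
    (r : ℕ) : ∃ D : ℝ, 1 ≤ D ∧ ∀ c ∈ A.centers, ∀ i ≤ r, ∀ x ∈ A.piece c,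
      ‖iteratedFDerivWithin ℝ i (e ∘ (chartAt (EuclideanSpace ℝ (Fin d)) c).symm)
        (chartAt (EuclideanSpace ℝ (Fin d)) c).target
        (chartAt (EuclideanSpace ℝ (Fin d)) c x)‖ ≤ D := by
  have h1 : ∀ (c : A.centers) (i : ℕ), ∃ C : ℝ, ∀ x ∈ A.piece c,
      ‖iteratedFDerivWithin ℝ i (e ∘ (chartAt (EuclideanSpace ℝ (Fin d)) (c : M)).symm)
        (chartAt (EuclideanSpace ℝ (Fin d)) (c : M)).target
        (chartAt (EuclideanSpace ℝ (Fin d)) (c : M) x)‖ ≤ C := by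
    intro c i
    refine (A.isCompact_piece c c.2).exists_bound_of_continuousOn ?_
    refine ((contDiffOn_comp_chartAt_symm he (c : M)).continuousOn_iteratedFDerivWithin
      (m := i) (by exact_mod_cast le_top)
      (chartAt (EuclideanSpace ℝ (Fin d)) (c : M)).open_target.uniqueDiffOn).comp
      ((chartAt (EuclideanSpace ℝ (Fin d)) (c : M)).continuousOn.mono (A.piece_subset c c.2)) ?_
    exact fun x hx => (chartAt (EuclideanSpace ℝ (Fin d)) (c : M)).map_source
      (A.piece_subset c c.2 hx)
  choose C hC using h1
  have h0 : 0 ≤ ∑ c : A.centers, ∑ i ∈ Finset.range (r + 1), |C c i| := by positivity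
  refine ⟨1 + ∑ c : A.centers, ∑ i ∈ Finset.range (r + 1), |C c i|, by linarith,
    fun c hc i hi x hx => ?_⟩
  have h2 := Finset.single_le_sum (f := fun i => |C ⟨c, hc⟩ i|) (fun _ _ => abs_nonneg _)
    (Finset.mem_range.2 (show i < r + 1 by omega))
  have h3 := Finset.single_le_sum
    (f := fun c : A.centers => ∑ i ∈ Finset.range (r + 1), |C c i|)
    (fun _ _ => Finset.sum_nonneg fun _ _ => abs_nonneg _) (Finset.mem_univ ⟨c, hc⟩)
  have h4 := (hC ⟨c, hc⟩ i x hx).trans (le_abs_self _)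
  simp only at h2 h3 h4
  linarith

/-- The `C^r` norm of a fixed profile, read in an ambient Euclidean space at scale `δ`. -/
lemma FiniteChartCover.exists_crNorm_rescale_le (A : FiniteChartCover d M)
    (he : ContMDiff (𝓡 d) 𝓘(ℝ, EuclideanSpace ℝ (Fin q)) ∞ e) (r : ℕ)
    {G : EuclideanSpace ℝ (Fin q) → ℝ} (hG : ContDiff ℝ ∞ G) {C : ℝ} (hC : 0 ≤ C)
    (hGC : ∀ i ≤ r, ∀ v, ‖iteratedFDeriv ℝ i G v‖ ≤ C) :
    ∃ K : ℝ, 0 ≤ K ∧ ∀ (p : EuclideanSpace ℝ (Fin q)) (δ : ℝ), 0 < δ → δ ≤ 1 →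
      A.crNorm r (fun x => G (δ⁻¹ • (e x - p))) ≤ K * δ⁻¹ ^ r := by
  obtain ⟨D, hD1, hD⟩ := A.exists_bound_iteratedFDerivWithin he r
  refine ⟨r.factorial * C * D ^ r, by positivity, fun p δ hδ hδ1 => ?_⟩
  have hδ' : 1 ≤ δ⁻¹ := (one_le_inv₀ hδ).2 hδ1
  have hE : 1 ≤ δ⁻¹ * D := one_le_mul_of_one_le_of_one_le hδ' hD1
  have hnn : 0 ≤ r.factorial * C * D ^ r * δ⁻¹ ^ r := by positivity
  refine Real.iSup_le (fun c => Real.iSup_le (fun k => Real.iSup_le (fun x => ?_) hnn) hnn) hnn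
  set χ := chartAt (EuclideanSpace ℝ (Fin d)) (c : M) with hχ
  have hx : χ x ∈ χ.target := χ.map_source (A.piece_subset c c.2 x.2)
  have hk : (k : ℕ) ≤ r := Nat.lt_succ_iff.1 k.2
  set h : EuclideanSpace ℝ (Fin d) → EuclideanSpace ℝ (Fin q) :=
    δ⁻¹ • (e ∘ χ.symm) - (fun _ => δ⁻¹ • p) with hh
  have hu := χ.open_target.uniqueDiffOn (𝕜 := ℝ)
  have hcd : ContDiffOn ℝ ∞ (e ∘ χ.symm) χ.target := contDiffOn_comp_chartAt_symm he (c : M)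
  have hcd' : ContDiffOn ℝ ∞ h χ.target := (hcd.const_smul δ⁻¹).sub (contDiffOn_const (c := δ⁻¹ • p))
  have heq : (fun x => G (δ⁻¹ • (e x - p))) ∘ χ.symm = G ∘ h := by
    ext z; simp [hh, smul_sub]
  rw [heq, ← iteratedFDerivWithin_of_isOpen _ χ.open_target hx]
  -- The Faà di Bruno estimate requires the `i`-th derivative of the inner map to be at most `(δ⁻¹ *
  -- D) ^ i` for `i ≥ 1` only. The translation by `p` drops out of these derivatives, whence a
  -- constant uniform in `p`.
  have key := norm_iteratedFDerivWithin_comp_le (n := (k : ℕ)) (N := ∞) hG.contDiffOn hcd'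
    (by exact_mod_cast le_top) uniqueDiffOn_univ hu (Set.mapsTo_univ _ _) hx (C := C)
    (D := δ⁻¹ * D) (fun i hi => by
      rw [iteratedFDerivWithin_univ]; exact hGC i (hi.trans hk) _) (fun i h1 hi => ?_)
  · refine key.trans ?_
    calc (k : ℕ).factorial * C * (δ⁻¹ * D) ^ (k : ℕ) ≤ r.factorial * C * (δ⁻¹ * D) ^ r := by
          gcongr
      _ = _ := by rw [mul_pow]; ring
  · have hat : ContDiffWithinAt ℝ i (e ∘ χ.symm) χ.target (χ x) :=
      (hcd _ hx).of_le (by exact_mod_cast le_top)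
    have hat' : ContDiffWithinAt ℝ i (δ⁻¹ • (e ∘ χ.symm)) χ.target (χ x) := hat.const_smul δ⁻¹
    rw [hh, iteratedFDerivWithin_sub_apply hat' contDiffWithinAt_const hu hx,
      iteratedFDerivWithin_const_of_ne (by omega), iteratedFDerivWithin_const_smul_apply hat hu hx,
      Pi.zero_apply, sub_zero, norm_smul, Real.norm_of_nonneg (by positivity)]
    calc δ⁻¹ * _ ≤ δ⁻¹ * D := by gcongr; exact hD c c.2 i (hi.trans hk) x x.2
      _ ≤ (δ⁻¹ * D) ^ i := le_self_pow₀ hE (by omega)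

end TestFunctions

/-! ### Consequences of exponential mixing: correlation of balls, ergodicity -/

lemma measureReal_le_integral_of_one_le {X : Type*} [MeasurableSpace X] {μ : Measure X}
    [IsFiniteMeasure μ] {φ : X → ℝ} (hi : Integrable φ μ) (h0 : ∀ x, 0 ≤ φ x) {s : Set X}
    (h1 : ∀ x ∈ s, 1 ≤ φ x) : μ.real s ≤ ∫ x, φ x ∂μ := by
  have := mul_meas_ge_le_integral_of_nonneg (Eventually.of_forall h0) hi 1
  rw [one_mul] at this
  exact (measureReal_mono h1).trans this

section Mixing

variable {d : ℕ} {M : Type*} [MetricSpace M] [CompactSpace M]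
  [ChartedSpace (EuclideanSpace ℝ (Fin d)) M] [IsManifold (𝓡 d) ∞ M]
  [MeasurableSpace M] [BorelSpace M] {μ : Measure M} [IsProbabilityMeasure μ]

lemma Continuous.integrable_of_compactSpace {φ : M → ℝ} (h : Continuous φ) : Integrable φ μ :=
  h.integrable_of_hasCompactSupport (HasCompactSupport.of_compactSpace φ)

/-- Test mixing on a bump `φ` at `x` of scale `δ` and on `ψ`, which is `0` on the `ρ`-ball about `y`
and `1` off the `2ρ`-ball. Since `f^[n]` maps the `δ`-ball into the `ρ`-ball, `φ · ψ ∘ fⁿ` vanishes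
identically and only the product of the integrals remains. -/
lemma IsExponentiallyMixing.measure_ball_mul_le {f : M → M} (hmix : IsExponentiallyMixing d f μ)
    {q : ℕ} {e : M → EuclideanSpace ℝ (Fin q)} (hiso : Isometry e)
    (he : ContMDiff (𝓡 d) 𝓘(ℝ, EuclideanSpace ℝ (Fin q)) ∞ e) :
    ∃ (r : ℕ) (C η : ℝ), 0 < η ∧ ∀ (x y : M) (δ ρ : ℝ) (n : ℕ), 0 < δ → δ ≤ 1 → 0 < ρ → ρ ≤ 1 →
      (∀ z, dist x z < δ → dist y (f^[n] z) < ρ) →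
      μ.real (Metric.ball x (δ / 2)) * μ.real (Metric.ball y (2 * ρ))ᶜ ≤
        C * Real.exp (-η * n) * δ⁻¹ ^ r * ρ⁻¹ ^ r := by
  obtain ⟨A, r, C, η, hC, hη, H⟩ := hmix
  let b₁ : ContDiffBump (0 : EuclideanSpace ℝ (Fin q)) :=
    ⟨1 / 2, 1, by norm_num, by norm_num⟩
  let b₂ : ContDiffBump (0 : EuclideanSpace ℝ (Fin q)) := ⟨1, 2, by norm_num, by norm_num⟩
  have hb₁ : ContDiff ℝ ∞ (b₁ : EuclideanSpace ℝ (Fin q) → ℝ) := b₁.contDiff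
  have hb₂ : ContDiff ℝ ∞ (b₂ : EuclideanSpace ℝ (Fin q) → ℝ) := b₂.contDiff
  obtain ⟨C₁, hC₁, hC₁'⟩ :=
    exists_bound_iteratedFDeriv_of_hasCompactSupport hb₁ b₁.hasCompactSupport r
  obtain ⟨C₂, hC₂, hC₂'⟩ :=
    exists_bound_iteratedFDeriv_of_hasCompactSupport hb₂ b₂.hasCompactSupport r
  have hG : ContDiff ℝ ∞ (fun v => 1 - b₂ v) :=
    contDiff_const.sub hb₂
  have hGb : ∀ i ≤ r, ∀ v, ‖iteratedFDeriv ℝ i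
      (fun v => 1 - b₂ v) v‖ ≤ 1 + C₂ := by
    intro i hi v
    rw [fun_iteratedFDeriv_sub_apply contDiffAt_const
      (hb₂.contDiffAt.of_le (by exact_mod_cast le_top))]
    refine (norm_sub_le _ _).trans (add_le_add ?_ (hC₂' i hi v))
    rcases Nat.eq_zero_or_pos i with rfl | hi0
    · simp
    · rw [iteratedFDeriv_const_of_ne hi0.ne']; simp
  obtain ⟨K₁, hK₁, hN₁⟩ := A.exists_crNorm_rescale_le he r hb₁ hC₁ hC₁'
  obtain ⟨K₂, hK₂, hN₂⟩ := A.exists_crNorm_rescale_le he r hG (by positivity) hGb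
  refine ⟨r, C * K₁ * K₂, η, hη, fun x y δ ρ n hδ hδ1 hρ hρ1 hsub => ?_⟩
  have hsm : ∀ {G : EuclideanSpace ℝ (Fin q) → ℝ}, ContDiff ℝ ∞ G →
      ∀ (p : EuclideanSpace ℝ (Fin q)) (s : ℝ),
      ContMDiff (𝓡 d) 𝓘(ℝ, ℝ) ∞ (fun x => G (s • (e x - p))) := by
    intro G hG p s
    have h1 : ContDiff ℝ ∞ (fun v => G (s • (v - p))) :=
      hG.comp ((contDiff_id.sub contDiff_const).const_smul s)
    exact h1.contMDiff.comp he
  have hnorm : ∀ {s : ℝ}, 0 < s → ∀ z w : M, ‖s⁻¹ • (e z - e w)‖ = dist w z / s := by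
    intro s hs z w
    rw [norm_smul, Real.norm_of_nonneg (by positivity), ← dist_eq_norm, hiso.dist_eq, dist_comm,
      div_eq_inv_mul]
  set φ : M → ℝ := fun z => b₁ (δ⁻¹ • (e z - e x)) with hφ
  set ψ : M → ℝ := fun z => 1 - b₂ (ρ⁻¹ • (e z - e y)) with hψ
  have hφs : ContMDiff (𝓡 d) 𝓘(ℝ, ℝ) ∞ φ := hsm hb₁ _ _
  have hψs : ContMDiff (𝓡 d) 𝓘(ℝ, ℝ) ∞ ψ := hsm hG _ _
  have h1 := H φ ψ (hφs.of_le (by exact_mod_cast le_top)) (hψs.of_le (by exact_mod_cast le_top)) n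
  have hzero : ∀ z, φ z * ψ (f^[n] z) = 0 := by
    intro z
    by_cases hz : dist x z < δ
    · have h2 := hsub z hz
      have : b₂ (ρ⁻¹ • (e (f^[n] z) - e y)) = 1 := by
        apply b₂.one_of_mem_closedBall
        rw [mem_closedBall_zero_iff, hnorm hρ]
        exact (div_le_one hρ).2 h2.le
      simp [hψ, this]
    · have : φ z = 0 := by
        apply b₁.zero_of_le_dist
        rw [dist_zero_right, hnorm hδ]
        exact (one_le_div hδ).2 (not_lt.1 hz)
      simp [this]
  simp only [hzero, integral_zero, zero_sub, abs_neg] at h1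
  have hφi : μ.real (Metric.ball x (δ / 2)) ≤ ∫ z, φ z ∂μ := by
    refine measureReal_le_integral_of_one_le hφs.continuous.integrable_of_compactSpace
      (fun z => b₁.nonneg) (fun z hz => ?_)
    refine (b₁.one_of_mem_closedBall ?_).ge
    rw [mem_closedBall_zero_iff, hnorm hδ]
    rw [Metric.mem_ball, dist_comm] at hz
    show dist x z / δ ≤ 1 / 2
    rw [div_le_iff₀ hδ]
    linarith
  have hψi : μ.real (Metric.ball y (2 * ρ))ᶜ ≤ ∫ z, ψ z ∂μ := by
    refine measureReal_le_integral_of_one_le hψs.continuous.integrable_of_compactSpace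
      (fun z => ?_) (fun z hz => ?_)
    · simpa [hψ] using b₂.le_one
    · have : b₂ (ρ⁻¹ • (e z - e y)) = 0 := by
        apply b₂.zero_of_le_dist
        rw [dist_zero_right, hnorm hρ]
        rw [Set.mem_compl_iff, Metric.mem_ball, not_lt, dist_comm] at hz
        exact (le_div_iff₀ hρ).2 hz
      simp [hψ, this]
  calc μ.real (Metric.ball x (δ / 2)) * μ.real (Metric.ball y (2 * ρ))ᶜ
      ≤ (∫ z, φ z ∂μ) * ∫ z, ψ z ∂μ :=
        mul_le_mul hφi hψi measureReal_nonneg (measureReal_nonneg.trans hφi)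
    _ ≤ _ := le_abs_self _
    _ ≤ C * Real.exp (-η * n) * A.crNorm r φ * A.crNorm r ψ := h1
    _ ≤ C * Real.exp (-η * n) * (K₁ * δ⁻¹ ^ r) * (K₂ * ρ⁻¹ ^ r) := by
        have hφ0 : 0 ≤ A.crNorm r φ := Real.iSup_nonneg fun _ => Real.iSup_nonneg fun _ =>
          Real.iSup_nonneg fun _ => norm_nonneg _
        have hψ0 : 0 ≤ A.crNorm r ψ := Real.iSup_nonneg fun _ => Real.iSup_nonneg fun _ =>
          Real.iSup_nonneg fun _ => norm_nonneg _
        have := hN₁ (e x) δ hδ hδ1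
        have := hN₂ (e y) ρ hρ hρ1
        gcongr
    _ = _ := by ring

/-- By regularity of `μ`, squeeze `A` between a closed `K` and an open `U`. A smooth Urysohn
function for the pair differs from the indicator only on `U \ K`. -/
lemma exists_contMDiff_integral_sub_indicator_le {A : Set M} (hA : MeasurableSet A) {ε : ℝ}
    (hε : 0 < ε) : ∃ φ : M → ℝ, ContMDiff (𝓡 d) 𝓘(ℝ, ℝ) ∞ φ ∧ (∀ x, φ x ∈ Set.Icc (0 : ℝ) 1) ∧
      ∫ x, |φ x - A.indicator 1 x| ∂μ ≤ ε := by
  have hε2 : ENNReal.ofReal (ε / 2) ≠ 0 := by simpa using hε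
  obtain ⟨K, hKA, hK, hμK⟩ := hA.exists_isClosed_sdiff_lt (measure_ne_top μ A) hε2
  obtain ⟨U, hAU, hU, -, hμU⟩ := hA.exists_isOpen_sdiff_lt (measure_ne_top μ A) hε2
  obtain ⟨φ, h0, h1, h01⟩ := exists_contMDiffMap_zero_one_of_isClosed (𝓡 d) (n := ⊤)
    hU.isClosed_compl hK (Set.disjoint_compl_left_iff_subset.2 (hKA.trans hAU))
  refine ⟨φ, φ.contMDiff, h01, ?_⟩
  have hle : ∀ x, |φ x - A.indicator 1 x| ≤ (U \ K).indicator 1 x := by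
    intro x
    by_cases hxK : x ∈ K
    · simp [hxK, hKA hxK, h1 hxK]
    by_cases hxU : x ∈ U
    · rw [Set.indicator_of_mem (show x ∈ U \ K from ⟨hxU, hxK⟩)]
      have := h01 x
      by_cases hxA : x ∈ A
      · rw [Set.indicator_of_mem hxA, Pi.one_apply, abs_le]
        constructor <;> linarith [this.1, this.2]
      · rw [Set.indicator_of_notMem hxA, Pi.one_apply, abs_le]
        constructor <;> linarith [this.1, this.2]
    · have hxA : x ∉ A := fun h => hxU (hAU h)
      have hz : φ x = 0 := h0 hxU
      simp [hxA, hz, hxU]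
  have hUK : MeasurableSet (U \ K) := hU.measurableSet.diff hK.measurableSet
  have hi : Integrable ((U \ K).indicator (1 : M → ℝ)) μ := (integrable_const (1 : ℝ)).indicator hUK
  calc ∫ x, |φ x - A.indicator 1 x| ∂μ ≤ ∫ x, (U \ K).indicator 1 x ∂μ :=
        integral_mono_of_nonneg (Eventually.of_forall fun _ => abs_nonneg _) hi
          (Eventually.of_forall hle)
    _ = μ.real (U \ K) := integral_indicator_one hUK
    _ ≤ μ.real (U \ A ∪ A \ K) := measureReal_mono (fun x hx => by
        by_cases hxA : x ∈ A
        · exact Or.inr ⟨hxA, hx.2⟩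
        · exact Or.inl ⟨hx.1, hxA⟩)
    _ ≤ μ.real (U \ A) + μ.real (A \ K) := measureReal_union_le _ _
    _ ≤ ε / 2 + ε / 2 := by
        gcongr
        · exact ENNReal.toReal_le_of_le_ofReal (by positivity) hμU.le
        · exact ENNReal.toReal_le_of_le_ofReal (by positivity) hμK.le
    _ = ε := by ring

/-- For an invariant set of measure `m`, approximate its indicator by a smooth `φ`. The correlations
`∫ φ · φ ∘ fⁿ` stay near `m` for all `n`, while mixing sends them to a number near `m ^ 2`; hence `m
= m ^ 2`. -/
lemma IsExponentiallyMixing.ergodic {f : M → M} (hmix : IsExponentiallyMixing d f μ)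
    (hμ : MeasurePreserving f μ μ) : Ergodic f μ := by
  refine ⟨hμ, ⟨fun A hA hfA => ?_⟩⟩
  obtain ⟨S, r, C, η, hC, hη, H⟩ := hmix
  have hiter : ∀ n x, A.indicator (1 : M → ℝ) (f^[n] x) = A.indicator 1 x := by
    intro n
    induction n with
    | zero => intro x; rfl
    | succ n ih =>
      intro x
      rw [Function.iterate_succ_apply, ih (f x)]
      by_cases hx : x ∈ A
      · have : f x ∈ A := by rw [← hfA] at hx; exact hx
        simp [hx, this]
      · have : f x ∉ A := fun h => hx (by rw [← hfA]; exact h)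
        simp [hx, this]
  set m := μ.real A with hm
  have hm0 : 0 ≤ m := measureReal_nonneg
  have hm1 : m ≤ 1 := measureReal_le_one
  have hIi : Integrable (A.indicator (1 : M → ℝ)) μ := (integrable_const (1 : ℝ)).indicator hA
  have hIm : ∫ x, A.indicator (1 : M → ℝ) x ∂μ = m := integral_indicator_one hA
  -- Of the error `4 * ε`, one half comes from replacing `φ · φ ∘ fⁿ` by the indicator and the other
  -- from replacing `(∫ φ) ^ 2` by `m ^ 2`.
  have key : ∀ ε > 0, |m - m * m| ≤ 4 * ε := by
    intro ε hε
    obtain ⟨φ, hφ, h01, hφA⟩ := exists_contMDiff_integral_sub_indicator_le (d := d) (μ := μ) hA hε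
    have hφi : Integrable φ μ := hφ.continuous.integrable_of_compactSpace
    have hdi : Integrable (fun x => |φ x - A.indicator 1 x|) μ := (hφi.sub hIi).abs
    have ha : |(∫ x, φ x ∂μ) - m| ≤ ε := by
      rw [← hIm, ← integral_sub hφi hIi]
      exact abs_integral_le_integral_abs.trans hφA
    have hprod : ∀ n : ℕ, |(∫ x, φ x * φ (f^[n] x) ∂μ) - m| ≤ 2 * ε := by
      intro n
      have hp := hμ.iterate n
      have hdn : Integrable (fun x => |φ (f^[n] x) - A.indicator 1 (f^[n] x)|) μ :=
        hp.integrable_comp_of_integrable hdi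
      have hdn' : ∫ x, |φ (f^[n] x) - A.indicator 1 (f^[n] x)| ∂μ ≤ ε := by
        refine le_trans (le_of_eq ?_) hφA
        conv_rhs => rw [← hp.map_eq]
        rw [integral_map hp.aemeasurable]
        rw [hp.map_eq]
        exact hdi.aestronglyMeasurable
      have hpi : Integrable (fun x => φ x * φ (f^[n] x)) μ := by
        refine Integrable.of_bound (C := 1) ?_ (Eventually.of_forall fun x => ?_)
        · exact hφi.aestronglyMeasurable.mul
            (hp.integrable_comp_of_integrable hφi).aestronglyMeasurable
        · rw [Real.norm_of_nonneg (mul_nonneg (h01 _).1 (h01 _).1)]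
          exact mul_le_one₀ (h01 _).2 (h01 _).1 (h01 _).2
      rw [← hIm, ← integral_sub hpi hIi]
      refine abs_integral_le_integral_abs.trans ?_
      have hb : ∀ x, |φ x * φ (f^[n] x) - A.indicator 1 x| ≤
          |φ x - A.indicator 1 x| + |φ (f^[n] x) - A.indicator 1 (f^[n] x)| := by
        intro x
        rw [hiter n x]
        have hx0 : A.indicator (1 : M → ℝ) x = 0 ∨ A.indicator (1 : M → ℝ) x = 1 := by
          by_cases hx : x ∈ A <;> simp [hx]
        have a1 := h01 x
        have a2 := h01 (f^[n] x)
        have a3 := mul_nonneg a1.1 a2.1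
        have a4 := mul_nonneg (sub_nonneg.2 a1.2) (sub_nonneg.2 a2.2)
        have a5 := mul_nonneg a1.1 (sub_nonneg.2 a2.2)
        rcases hx0 with h | h <;> rw [h]
        · rw [sub_zero, sub_zero, sub_zero, abs_of_nonneg a3, abs_of_nonneg a1.1,
            abs_of_nonneg a2.1]
          nlinarith [a2.1]
        · rw [abs_of_nonpos (by linarith [a1.2] : φ x - 1 ≤ 0),
            abs_of_nonpos (by linarith [a2.2] : φ (f^[n] x) - 1 ≤ 0),
            abs_of_nonpos (by nlinarith [a1.2])]
          nlinarith
      calc ∫ x, |φ x * φ (f^[n] x) - A.indicator 1 x| ∂μ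
          ≤ ∫ x, (|φ x - A.indicator 1 x| + |φ (f^[n] x) - A.indicator 1 (f^[n] x)|) ∂μ :=
            integral_mono (hpi.sub hIi).abs (hdi.add hdn) hb
        _ = _ := integral_add hdi hdn
        _ ≤ 2 * ε := by linarith
    have hφr : ContMDiff (𝓡 d) 𝓘(ℝ, ℝ) (r : WithTop ℕ∞) φ := hφ.of_le (by exact_mod_cast le_top)
    have hlim : Tendsto (fun n : ℕ => C * Real.exp (-η * n) * S.crNorm r φ * S.crNorm r φ) atTop
        (𝓝 (C * 0 * S.crNorm r φ * S.crNorm r φ)) := by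
      refine ((Tendsto.const_mul _ (Real.tendsto_exp_atBot.comp ?_)).mul_const _).mul_const _
      exact Tendsto.const_mul_atTop_of_neg (by linarith) tendsto_natCast_atTop_atTop
    have hε' : |m - m * m| ≤ 4 * ε + C * 0 * S.crNorm r φ * S.crNorm r φ := by
      refine ge_of_tendsto (hlim.const_add (4 * ε)) (Eventually.of_forall fun n => ?_)
      have b1 := H φ φ hφr hφr n
      have b2 := hprod n
      set a := ∫ x, φ x ∂μ with ha'
      have b3 : |a * a - m * m| ≤ 2 * ε := by
        have ha0 : 0 ≤ a := integral_nonneg fun x => (h01 x).1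
        have ha1 : a ≤ 1 := by
          calc a ≤ ∫ _, (1 : ℝ) ∂μ := integral_mono hφi (integrable_const _) fun x => (h01 x).2
            _ = 1 := by simp
        rw [show a * a - m * m = (a + m) * (a - m) by ring, abs_mul, abs_of_nonneg (by positivity)]
        exact mul_le_mul (by linarith) ha (abs_nonneg _) (by norm_num)
      rw [abs_le] at *
      constructor <;> linarith [b1.1, b1.2, b2.1, b2.2, b3.1, b3.2]
    simpa using hε'
  have hmm : m - m * m = 0 := by
    by_contra hne
    have := key (|m - m * m| / 8) (by positivity)
    have h0 : 0 < |m - m * m| := abs_pos.2 hne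
    linarith
  have : m = 0 ∨ m = 1 := by
    rcases mul_eq_zero.1 (show m * (1 - m) = 0 by linarith) with h | h
    · exact Or.inl h
    · exact Or.inr (by linarith)
  rw [eventuallyConst_set']
  rcases this with h | h
  · left
    rw [ae_eq_empty]
    exact (measureReal_eq_zero_iff).1 h
  · right
    rw [ae_eq_univ, ← measureReal_eq_zero_iff, probReal_compl_eq_one_sub hA, ← hm, h, sub_self]

end Mixing

/-! ### Comparing increments with derivatives in normed spaces -/

section NormedSpace

variable {E F G : Type*} [NormedAddCommGroup E] [NormedSpace ℝ E] [NormedAddCommGroup F]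
  [NormedSpace ℝ F] [NormedAddCommGroup G] [NormedSpace ℝ G]

/-- Strict differentiability replaces both increments by their linear parts up to `ε * ‖w‖`. Since
`u'` is bounded below, `‖w‖` is controlled by the increment of `u`, which absorbs both errors. -/
lemma HasStrictFDerivAt.eventually_norm_sub_le_mul {u : E → F} {v : E → G} {u' : E →L[ℝ] F}
    {v' : E →L[ℝ] G} {a : E} (hu : HasStrictFDerivAt u u' a) (hv : HasStrictFDerivAt v v' a)
    {κ : ℝ} (hκ : 0 < κ) (hu' : ∀ w, ‖w‖ ≤ κ * ‖u' w‖) {c₀ c : ℝ} (hc₀ : 0 ≤ c₀)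
    (hle : ∀ w, ‖v' w‖ ≤ c₀ * ‖u' w‖) (hc : c₀ < c) :
    ∀ᶠ p : E × E in 𝓝 (a, a), ‖v p.1 - v p.2‖ ≤ c * ‖u p.1 - u p.2‖ := by
  -- The first term gives `‖w‖ ≤ 2 * κ * ‖u p.1 - u p.2‖`; the second then keeps the total error `ε
  -- * (1 + c₀) * ‖w‖` within `(c - c₀) * ‖u p.1 - u p.2‖`.
  set ε := min (1 / (2 * κ)) ((c - c₀) / (2 * κ * (1 + c₀))) with hε
  have hcc : 0 < c - c₀ := sub_pos.2 hc
  have hε0 : 0 < ε := lt_min (by positivity) (by positivity)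
  have h1 := (Asymptotics.isLittleO_iff.1 hu.isLittleO) hε0
  have h2 := (Asymptotics.isLittleO_iff.1 hv.isLittleO) hε0
  filter_upwards [h1, h2] with p hp1 hp2
  set w := p.1 - p.2
  have h3 : ‖u' w‖ ≤ ‖u p.1 - u p.2‖ + ε * ‖w‖ := by
    have := norm_sub_norm_le (u' w) (u p.1 - u p.2)
    rw [norm_sub_rev (u' w)] at this
    linarith
  have h4 : ‖v p.1 - v p.2‖ ≤ ‖v' w‖ + ε * ‖w‖ := by
    have := norm_sub_norm_le (v p.1 - v p.2) (v' w)
    linarith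
  have hw := hu' w
  have e1 : ε * (2 * κ) ≤ 1 := by
    have := min_le_left (1 / (2 * κ)) ((c - c₀) / (2 * κ * (1 + c₀)))
    rw [← hε] at this
    rwa [le_div_iff₀ (by positivity)] at this
  have e2 : ε * (2 * κ * (1 + c₀)) ≤ c - c₀ := by
    have := min_le_right (1 / (2 * κ)) ((c - c₀) / (2 * κ * (1 + c₀)))
    rw [← hε] at this
    rwa [le_div_iff₀ (by positivity)] at this
  set U := ‖u p.1 - u p.2‖
  have hU : 0 ≤ U := norm_nonneg _
  have h5 : ‖w‖ ≤ 2 * κ * U := by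
    have a1 : κ * ‖u' w‖ ≤ κ * (U + ε * ‖w‖) := by gcongr
    have a2 : ε * (2 * κ) * ‖w‖ ≤ 1 * ‖w‖ := by gcongr
    nlinarith
  have h6 : c₀ * ‖u' w‖ ≤ c₀ * (U + ε * ‖w‖) := by gcongr
  have h7 : ε * (1 + c₀) * ‖w‖ ≤ ε * (1 + c₀) * (2 * κ * U) := by gcongr
  have h8 : ε * (2 * κ * (1 + c₀)) * U ≤ (c - c₀) * U := by gcongr
  have h9 := hle w
  nlinarith

/-- Divide the inequality on the line `a + t • w` by `|t|` and let `t → 0`. -/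
lemma HasFDerivAt.norm_apply_le_mul {u : E → F} {v : E → G} {u' : E →L[ℝ] F}
    {v' : E →L[ℝ] G} {a : E} (hu : HasFDerivAt u u' a) (hv : HasFDerivAt v v' a) {c : ℝ}
    (h : ∀ᶠ b in 𝓝 a, ‖v b - v a‖ ≤ c * ‖u b - u a‖) (w : E) : ‖v' w‖ ≤ c * ‖u' w‖ := by
  have hline : Tendsto (fun t : ℝ => a + t • w) (𝓝[≠] 0) (𝓝 a) := by
    have : Continuous (fun t : ℝ => a + t • w) := by fun_prop
    have := this.tendsto 0
    simp only [zero_smul, add_zero] at this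
    exact this.mono_left nhdsWithin_le_nhds
  have h1 := ((hu.hasLineDerivAt w).tendsto_slope_zero).norm
  have h2 := ((hv.hasLineDerivAt w).tendsto_slope_zero).norm
  refine le_of_tendsto_of_tendsto h2 (h1.const_mul c) ?_
  filter_upwards [hline.eventually h] with t ht
  rw [norm_smul, norm_smul, mul_left_comm]
  gcongr

end NormedSpace

/-! ### Derivatives of `C¹` maps read in charts -/

section Manifold

variable {d : ℕ} {M : Type*} [TopologicalSpace M] [ChartedSpace (EuclideanSpace ℝ (Fin d)) M]
  {V : Type*} [NormedAddCommGroup V] [NormedSpace ℝ V]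

variable (d) in
/-- The derivative of a map from a manifold to a normed space, as a linear map on the model
space. -/
def modelDeriv (h : M → V) (x : M) : EuclideanSpace ℝ (Fin d) →L[ℝ] V := mfderiv (𝓡 d) 𝓘(ℝ, V) h x

lemma ContMDiff.hasStrictFDerivAt_comp_extChartAt_symm {h : M → V}
    (hh : ContMDiff (𝓡 d) 𝓘(ℝ, V) 1 h) (x : M) :
    HasStrictFDerivAt (h ∘ (extChartAt (𝓡 d) x).symm) (modelDeriv d h x)
      (extChartAt (𝓡 d) x x) := by
  have h1 : ContDiffAt ℝ 1 (h ∘ (extChartAt (𝓡 d) x).symm) (extChartAt (𝓡 d) x x) := by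
    have := ((contMDiffAt_iff (x := x)).1 (hh x)).2
    simpa [contDiffWithinAt_univ, extChartAt_model_space_eq_id, -extChartAt] using this
  have h2 : modelDeriv d h x =
      fderiv ℝ (h ∘ (extChartAt (𝓡 d) x).symm) (extChartAt (𝓡 d) x x) := by
    rw [modelDeriv, (hh.mdifferentiableAt one_ne_zero).mfderiv]
    simp only [writtenInExtChartAt, extChartAt_model_space_eq_id, modelWithCornersSelf_coe,
      Set.range_id, fderivWithin_univ]
    rfl
  rw [h2]
  exact h1.hasStrictFDerivAt one_ne_zero

lemma exists_norm_le_mul_of_injective {L : EuclideanSpace ℝ (Fin d) →L[ℝ] V}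
    (hL : Function.Injective L) : ∃ κ > 0, ∀ w, ‖w‖ ≤ κ * ‖L w‖ := by
  obtain ⟨K, hK, hK'⟩ := LinearMap.exists_antilipschitzWith (L : EuclideanSpace ℝ (Fin d) →ₗ[ℝ] V)
    (LinearMap.ker_eq_bot.2 hL)
  exact ⟨K, hK, fun w => by simpa using hK'.le_mul_dist w 0⟩

end Manifold

/-! ### Infinitesimal Lipschitz constants versus derivatives -/

section Immersion

variable {d : ℕ} {M : Type*} [MetricSpace M]
  [ChartedSpace (EuclideanSpace ℝ (Fin d)) M]
  {V : Type*} [NormedAddCommGroup V] [NormedSpace ℝ V] {e : M → V} {F : M → M}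

lemma eventually_extChartAt_symm_eq (x : M) :
    ∀ᶠ z in 𝓝 x, (extChartAt (𝓡 d) x).symm (extChartAt (𝓡 d) x z) = z := by
  filter_upwards [extChartAt_source_mem_nhds (I := 𝓡 d) x] with z hz
  exact (extChartAt (𝓡 d) x).left_inv hz

/-- Through the isometry, distances are norms of increments of `e` and of `e ∘ F`, so the
normed-space comparison applies in a chart. Injectivity of the derivative of `e` provides its lower
bound. -/
lemma eventually_dist_le_of_norm_modelDeriv_le (hiso : Isometry e)
    (he : ContMDiff (𝓡 d) 𝓘(ℝ, V) 1 e) (hF : ContMDiff (𝓡 d) (𝓡 d) 1 F) {x : M}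
    (him : Function.Injective (modelDeriv d e x)) {c₀ c : ℝ} (hc₀ : 0 ≤ c₀)
    (hle : ∀ w : EuclideanSpace ℝ (Fin d), ‖modelDeriv d (e ∘ F) x w‖ ≤
      c₀ * ‖modelDeriv d e x w‖) (hc : c₀ < c) :
    ∀ᶠ p : M × M in 𝓝 (x, x), dist (F p.1) (F p.2) ≤ c * dist p.1 p.2 := by
  obtain ⟨κ, hκ, hκ'⟩ := exists_norm_le_mul_of_injective him
  have h1 := (he.hasStrictFDerivAt_comp_extChartAt_symm x).eventually_norm_sub_le_mul
    ((ContMDiff.comp he hF).hasStrictFDerivAt_comp_extChartAt_symm x) hκ hκ' hc₀ hle hc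
  have h2 : Tendsto (fun p : M × M => (extChartAt (𝓡 d) x p.1, extChartAt (𝓡 d) x p.2))
      (𝓝 (x, x)) (𝓝 (extChartAt (𝓡 d) x x, extChartAt (𝓡 d) x x)) := by
    rw [nhds_prod_eq, nhds_prod_eq]
    exact (continuousAt_extChartAt (I := 𝓡 d) x).tendsto.prodMap
      (continuousAt_extChartAt (I := 𝓡 d) x).tendsto
  have h3 : ∀ᶠ p : M × M in 𝓝 (x, x),
      (extChartAt (𝓡 d) x).symm (extChartAt (𝓡 d) x p.1) = p.1 ∧
      (extChartAt (𝓡 d) x).symm (extChartAt (𝓡 d) x p.2) = p.2 := by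
    rw [nhds_prod_eq]
    exact (eventually_extChartAt_symm_eq x).prod_mk (eventually_extChartAt_symm_eq x)
  filter_upwards [h2.eventually h1, h3] with p hp hp3
  simp only [Function.comp_apply, hp3.1, hp3.2] at hp
  rwa [← dist_eq_norm, ← dist_eq_norm, hiso.dist_eq, hiso.dist_eq] at hp

lemma exists_lipschitzWith_of_contMDiff [CompactSpace M] (hiso : Isometry e)
    (he : ContMDiff (𝓡 d) 𝓘(ℝ, V) 1 e) (hF : ContMDiff (𝓡 d) (𝓡 d) 1 F)
    (him : ∀ x, Function.Injective (modelDeriv d e x)) :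
    ∃ K : ℝ≥0, LipschitzWith K F := by
  suffices h : LocallyLipschitzOn Set.univ F by
    obtain ⟨K, hK⟩ := h.exists_lipschitzOnWith_of_compact isCompact_univ
    exact ⟨K, lipschitzOnWith_univ.1 hK⟩
  intro x _
  obtain ⟨κ, hκ, hκ'⟩ := exists_norm_le_mul_of_injective (him x)
  set L := modelDeriv d (e ∘ F) x
  have hL : ∀ w, ‖L w‖ ≤ ‖L‖ * κ * ‖modelDeriv d e x w‖ := fun w =>
    (L.le_opNorm w).trans (by rw [mul_assoc]; gcongr; exact hκ' w)
  have h1 := eventually_dist_le_of_norm_modelDeriv_le hiso he hF (him x) (c₀ := ‖L‖ * κ)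
    (c := ‖L‖ * κ + 1) (by positivity) hL (by linarith)
  rw [nhds_prod_eq, eventually_prod_self_iff'] at h1
  obtain ⟨t, ht, H⟩ := h1
  rw [nhdsWithin_univ]
  refine ⟨⟨‖L‖ * κ + 1, by positivity⟩, t, ht, ?_⟩
  exact LipschitzOnWith.of_dist_le_mul fun a ha b hb => H a ha b hb

lemma norm_modelDeriv_le_ptLip_mul (hiso : Isometry e)
    (he : ContMDiff (𝓡 d) 𝓘(ℝ, V) 1 e) (hF : ContMDiff (𝓡 d) (𝓡 d) 1 F) {K : ℝ≥0}
    (hK : LipschitzWith K F) (x : M) (w : EuclideanSpace ℝ (Fin d)) :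
    ‖modelDeriv d (e ∘ F) x w‖ ≤
      ptLip F x * ‖modelDeriv d e x w‖ := by
  have key : ∀ c, ptLip F x < c → ‖modelDeriv d (e ∘ F) x w‖ ≤
      c * ‖modelDeriv d e x w‖ := by
    intro c hc
    refine (he.hasStrictFDerivAt_comp_extChartAt_symm x).hasFDerivAt.norm_apply_le_mul
      ((ContMDiff.comp he hF).hasStrictFDerivAt_comp_extChartAt_symm x).hasFDerivAt ?_ w
    have h1 : Tendsto (extChartAt (𝓡 d) x).symm (𝓝 (extChartAt (𝓡 d) x x)) (𝓝 x) := by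
      have := continuousAt_extChartAt_symm (I := 𝓡 d) x
      rwa [ContinuousAt, extChartAt_to_inv] at this
    filter_upwards [h1.eventually (eventually_dist_le_of_ptLip_lt hK hc)] with b hb
    simp only [Function.comp_apply, extChartAt_to_inv]
    rw [← dist_eq_norm, ← dist_eq_norm, hiso.dist_eq, hiso.dist_eq, dist_comm (F _), dist_comm _ x]
    exact hb
  have ht : Tendsto (fun c : ℝ => c * ‖modelDeriv d e x w‖) (𝓝[>] (ptLip F x))
      (𝓝 (ptLip F x * ‖modelDeriv d e x w‖)) :=
    ((continuous_id.mul continuous_const).tendsto _).mono_left nhdsWithin_le_nhds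
  exact ge_of_tendsto ht (eventually_mem_nhdsWithin.mono fun c hc => key c hc)

/-- The norm of a linear map is at most the sum of the norms of its values on the standard basis. It
is essential that `κ` does not depend on `F`: for `F = f^[n]` it disappears from the exponential
rate. -/
lemma exists_ptLip_le_sum_norm_modelDeriv (hiso : Isometry e) (he : ContMDiff (𝓡 d) 𝓘(ℝ, V) 1 e)
    {x : M} (him : Function.Injective (modelDeriv d e x)) :
    ∃ κ > 0, ∀ (F : M → M) (K : ℝ≥0), LipschitzWith K F → ContMDiff (𝓡 d) (𝓡 d) 1 F →
      ptLip F x ≤ κ * ∑ i : Fin d,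
        ‖modelDeriv d (e ∘ F) x (EuclideanSpace.single i (1 : ℝ))‖ := by
  obtain ⟨κ, hκ, hκ'⟩ := exists_norm_le_mul_of_injective him
  refine ⟨κ, hκ, fun F K hK hF => ?_⟩
  set L := modelDeriv d (e ∘ F) x
  set S := ∑ i : Fin d, ‖L (EuclideanSpace.single i (1 : ℝ))‖ with hS
  have hS0 : 0 ≤ S := by positivity
  have hL : ∀ w, ‖L w‖ ≤ S * ‖w‖ := by
    intro w
    have hw : w = ∑ i, w i • EuclideanSpace.single i (1 : ℝ) := by
      have := (EuclideanSpace.basisFun (Fin d) ℝ).sum_repr w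
      simpa using this.symm
    conv_lhs => rw [hw, map_sum]
    rw [hS, Finset.sum_mul]
    refine (norm_sum_le _ _).trans (Finset.sum_le_sum fun i _ => ?_)
    rw [map_smul, norm_smul, mul_comm]
    gcongr
    exact PiLp.norm_apply_le w i
  have hL' : ∀ w, ‖L w‖ ≤ κ * S * ‖modelDeriv d e x w‖ := fun w =>
    (hL w).trans (by rw [mul_comm κ, mul_assoc]; gcongr; exact hκ' w)
  have key : ∀ c, κ * S < c → ptLip F x ≤ c := by
    intro c hc
    have h1 := eventually_dist_le_of_norm_modelDeriv_le hiso he hF him (c₀ := κ * S)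
      (by positivity) hL' hc
    refine ptLip_le_of_eventually hK ((by positivity : 0 ≤ κ * S).trans hc.le) ?_
    rw [nhds_prod_eq] at h1
    exact h1.curry.self_of_nhds
  exact le_of_forall_gt_imp_ge_of_dense key

end Immersion

/-! ### Equivalence of norms on the tangent bundle -/

section TangentBundle

variable {d : ℕ} {M : Type*} [TopologicalSpace M] [T2Space M] [CompactSpace M]
  [ChartedSpace (EuclideanSpace ℝ (Fin d)) M] [IsManifold (𝓡 d) ∞ M]

/-- Any two continuous families of norms on the tangent spaces of a compact manifold are
equivalent. -/
lemma exists_forall_le_mul_of_homogeneous {N₁ N₂ : TangentBundle (𝓡 d) M → ℝ}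
    (h₁ : Continuous N₁) (h₂ : Continuous N₂)
    (hom₁ : ∀ (x : M) (c : ℝ) (v : TangentSpace (𝓡 d) x), 0 ≤ c → N₁ ⟨x, c • v⟩ = c * N₁ ⟨x, v⟩)
    (hom₂ : ∀ (x : M) (c : ℝ) (v : TangentSpace (𝓡 d) x), 0 ≤ c → N₂ ⟨x, c • v⟩ = c * N₂ ⟨x, v⟩)
    (pos₂ : ∀ (x : M) (v : TangentSpace (𝓡 d) x), v ≠ 0 → 0 < N₂ ⟨x, v⟩) :
    ∃ C > 0, ∀ (x : M) (v : TangentSpace (𝓡 d) x), N₁ ⟨x, v⟩ ≤ C * N₂ ⟨x, v⟩ := by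
  have hzero₁ : ∀ x : M, N₁ ⟨x, (0 : TangentSpace (𝓡 d) x)⟩ = 0 := fun x => by
    have := hom₁ x 0 0 le_rfl
    rwa [zero_smul, zero_mul] at this
  have hzero₂ : ∀ x : M, N₂ ⟨x, (0 : TangentSpace (𝓡 d) x)⟩ = 0 := fun x => by
    have := hom₂ x 0 0 le_rfl
    rwa [zero_smul, zero_mul] at this
  have nonneg₂ : ∀ (x : M) (v : TangentSpace (𝓡 d) x), 0 ≤ N₂ ⟨x, v⟩ := fun x v => by
    by_cases hv : v = 0
    · rw [hv, hzero₂]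
    · exact (pos₂ x v hv).le
  have hloc : ∀ x₀ : M, ∃ C : ℝ, ∀ᶠ x in 𝓝 x₀, ∀ v : TangentSpace (𝓡 d) x,
      N₁ ⟨x, v⟩ ≤ C * N₂ ⟨x, v⟩ := by
    intro x₀
    set τ := trivializationAt (EuclideanSpace ℝ (Fin d)) (TangentSpace (𝓡 d) : M → Type _) x₀
      with hτ
    have hb : τ.baseSet ∈ 𝓝 x₀ := τ.open_baseSet.mem_nhds
      (FiberBundle.mem_baseSet_trivializationAt' x₀)
    -- In a trivialization, `N₁ / N₂` is continuous, hence bounded, on a compact neighbourhood times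
    -- the unit sphere. Homogeneity extends the bound to all vectors.
    obtain ⟨K, hK, hKb, hKc⟩ := local_compact_nhds hb
    set S := K ×ˢ Metric.sphere (0 : EuclideanSpace ℝ (Fin d)) 1 with hS
    have hSc : IsCompact S := hKc.prod (isCompact_sphere _ _)
    have hτc : ContinuousOn (fun z : M × EuclideanSpace ℝ (Fin d) =>
        (⟨z.1, τ.symm z.1 z.2⟩ : TangentBundle (𝓡 d) M)) S :=
      (τ.continuousOn_symm).mono (Set.prod_mono hKb (Set.subset_univ _))
    have hne : ∀ z ∈ S, τ.symm z.1 z.2 ≠ 0 := by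
      rintro ⟨x, w⟩ ⟨hx, hw⟩ h0
      have h1 := τ.apply_mk_symm (hKb hx) w
      simp only at h0
      rw [h0] at h1
      have h2 := τ.apply_eq_prod_continuousLinearEquivAt ℝ x (hKb hx) 0
      rw [map_zero] at h2
      have h3 : w = 0 := by
        have := h1.symm.trans h2
        exact (Prod.ext_iff.1 this).2
      simp [h3] at hw
    obtain ⟨C, hC⟩ := hSc.exists_bound_of_continuousOn
      ((h₁.comp_continuousOn hτc).div (h₂.comp_continuousOn hτc)
        (fun z hz => (pos₂ _ _ (hne z hz)).ne'))
    refine ⟨C, ?_⟩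
    filter_upwards [hK] with x hx v
    by_cases hv : v = 0
    · rw [hv, hzero₁, hzero₂, mul_zero]
    set w := τ.continuousLinearEquivAt ℝ x (hKb hx) v with hw
    have hw0 : w ≠ 0 := fun h =>
      hv ((τ.continuousLinearEquivAt ℝ x (hKb hx)).map_eq_zero_iff.1 h)
    have hwn : 0 < ‖w‖ := norm_pos_iff.2 hw0
    have hvw : v = ‖w‖ • τ.symm x (‖w‖⁻¹ • w) := by
      have h1 : τ.symm x (‖w‖⁻¹ • w) =
          (τ.continuousLinearEquivAt ℝ x (hKb hx)).symm (‖w‖⁻¹ • w) := rfl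
      rw [h1, map_smul, smul_smul, mul_inv_cancel₀ hwn.ne', one_smul, hw]
      exact (ContinuousLinearEquiv.symm_apply_apply _ _).symm
    have hmem : (x, ‖w‖⁻¹ • w) ∈ S := by
      refine ⟨hx, ?_⟩
      rw [mem_sphere_zero_iff_norm, norm_smul, norm_inv, norm_norm, inv_mul_cancel₀ hwn.ne']
    have h1 : N₁ ⟨x, τ.symm x (‖w‖⁻¹ • w)⟩ / N₂ ⟨x, τ.symm x (‖w‖⁻¹ • w)⟩ ≤ C :=
      (le_abs_self _).trans (hC _ hmem)
    have hpos := pos₂ x _ (hne _ hmem)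
    rw [div_le_iff₀ hpos] at h1
    rw [hvw, hom₁ _ _ _ hwn.le, hom₂ _ _ _ hwn.le, mul_left_comm]
    gcongr
  choose C hC using hloc
  obtain ⟨t, ht⟩ := CompactSpace.elim_nhds_subcover _ hC
  have hnn : 0 ≤ ∑ x ∈ t, |C x| := by positivity
  refine ⟨1 + ∑ x ∈ t, |C x|, by positivity, fun x v => ?_⟩
  obtain ⟨y, hy, hxy⟩ : ∃ y ∈ t, x ∈ {x | ∀ v : TangentSpace (𝓡 d) x,
      N₁ ⟨x, v⟩ ≤ C y * N₂ ⟨x, v⟩} := by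
    have : x ∈ (⊤ : Set M) := trivial
    rw [← ht] at this
    simpa using this
  refine (hxy v).trans ?_
  have h1 : C y ≤ 1 + ∑ x ∈ t, |C x| := by
    have := Finset.single_le_sum (f := fun x => |C x|) (fun _ _ => abs_nonneg _) hy
    linarith [le_abs_self (C y)]
  have := nonneg₂ x v
  gcongr

omit [T2Space M] [CompactSpace M] in
lemma continuous_norm_modelDeriv {V : Type*} [NormedAddCommGroup V] [NormedSpace ℝ V] {e : M → V}
    (he : ContMDiff (𝓡 d) 𝓘(ℝ, V) 1 e) :
    Continuous fun z : TangentBundle (𝓡 d) M => ‖modelDeriv d e z.1 z.2‖ := by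
  have h1 : Continuous (tangentMap (𝓡 d) 𝓘(ℝ, V) e) := he.continuous_tangentMap le_rfl
  exact (continuous_snd.comp
    ((tangentBundleModelSpaceHomeomorph 𝓘(ℝ, V)).continuous.comp h1)).norm

omit [T2Space M] [CompactSpace M] in
lemma continuous_sqrt_inner
    (g : Bundle.ContinuousRiemannianMetric (EuclideanSpace ℝ (Fin d))
      (fun x : M => TangentSpace (𝓡 d) x)) :
    Continuous fun z : TangentBundle (𝓡 d) M => Real.sqrt (g.inner z.1 z.2 z.2) := by
  refine Real.continuous_sqrt.comp ?_
  have hid : Continuous (fun z : TangentBundle (𝓡 d) M =>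
      (⟨z.1, z.2⟩ : TangentBundle (𝓡 d) M)) := continuous_id
  have hproj : Continuous (fun z : TangentBundle (𝓡 d) M => z.1) :=
    FiberBundle.continuous_proj (EuclideanSpace ℝ (Fin d)) (fun x : M => TangentSpace (𝓡 d) x)
  have h1 : Continuous (fun z : TangentBundle (𝓡 d) M =>
      Bundle.TotalSpace.mk' ℝ (E := Bundle.Trivial M ℝ) z.1 (g.inner z.1 z.2 z.2)) :=
    (g.continuous.comp hproj).clm_bundle_apply₂ (F₁ := EuclideanSpace ℝ (Fin d))
      (F₂ := EuclideanSpace ℝ (Fin d)) hid hid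
  rw [continuous_iff_continuousAt] at h1 ⊢
  intro z
  have h2 := h1 z
  simp only [FiberBundle.continuousAt_totalSpace] at h2
  exact h2.2

end TangentBundle

/-! ### The growth rate of the infinitesimal Lipschitz constants -/

lemma EReal.limsup_coe_le_of_le_add {u v w : ℕ → ℝ} (h : ∀ᶠ n in atTop, v n ≤ u n + w n)
    (hw : Tendsto w atTop (𝓝 0)) :
    limsup (fun n => (v n : EReal)) atTop ≤ limsup (fun n => (u n : EReal)) atTop := by
  have hw' : Tendsto (fun n => (w n : EReal)) atTop (𝓝 ((0 : ℝ) : EReal)) :=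
    EReal.tendsto_coe.2 hw
  have hl := hw'.limsup_eq
  calc limsup (fun n => (v n : EReal)) atTop
      ≤ limsup ((fun n => (u n : EReal)) + fun n => (w n : EReal)) atTop := by
        refine limsup_le_limsup (h.mono fun n hn => ?_)
        show (v n : EReal) ≤ u n + w n
        exact_mod_cast hn
    _ ≤ limsup (fun n => (u n : EReal)) atTop + limsup (fun n => (w n : EReal)) atTop := by
        refine EReal.limsup_add_le (Or.inr ?_) (Or.inr ?_) <;> rw [hl] <;> simp
    _ = _ := by rw [hl]; simp

section LipGrowth

open Real

variable {X : Type*} [MetricSpace X] {K : ℝ≥0} {f : X → X}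

/-- The exponential growth rate, if positive, of the infinitesimal Lipschitz constants of the
iterates of `f`. -/
def lipGrowth (f : X → X) (x : X) : EReal :=
  limsup (fun n : ℕ => ((1 / (n : ℝ) * log⁺ (ptLip f^[n] x) : ℝ) : EReal)) atTop

lemma inv_mul_posLog_ptLip_nonneg (n : ℕ) (x : X) : 0 ≤ 1 / (n : ℝ) * log⁺ (ptLip f^[n] x) :=
  mul_nonneg (by positivity) posLog_nonneg

lemma inv_mul_posLog_ptLip_le (hf : LipschitzWith K f) (n : ℕ) (x : X) :
    1 / (n : ℝ) * log⁺ (ptLip f^[n] x) ≤ log⁺ (K : ℝ) := by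
  rcases Nat.eq_zero_or_pos n with rfl | hn
  · simpa using posLog_nonneg
  have hn' : (0 : ℝ) < n := by exact_mod_cast hn
  have := posLog_le_posLog (ptLip_nonneg _ _) (ptLip_le_lipschitz (hf.iterate n) x)
  rw [NNReal.coe_pow, posLog_pow] at this
  rw [one_div, inv_mul_le_iff₀ hn']
  exact this

lemma lipGrowth_nonneg (x : X) : 0 ≤ lipGrowth f x :=
  le_limsup_of_frequently_le (Frequently.of_forall fun n => by
    exact_mod_cast inv_mul_posLog_ptLip_nonneg n x)

lemma lipGrowth_le (hf : LipschitzWith K f) (x : X) : lipGrowth f x ≤ (log⁺ (K : ℝ) : ℝ) :=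
  limsup_le_of_le (h := Eventually.of_forall fun n => by
    exact_mod_cast inv_mul_posLog_ptLip_le hf n x)

lemma lipGrowth_eq_coe_toReal (hf : LipschitzWith K f) (x : X) :
    ((lipGrowth f x).toReal : EReal) = lipGrowth f x :=
  EReal.coe_toReal (ne_top_of_le_ne_top (EReal.coe_ne_top _) (lipGrowth_le hf x))
    (ne_bot_of_le_ne_bot EReal.zero_ne_bot (lipGrowth_nonneg x))

/-- Shift the index by one and use `ptLip_comp_le`; the additional `log⁺ K` is killed by the factor
`1 / (n + 1)`. -/
lemma lipGrowth_le_comp (hf : LipschitzWith K f) (x : X) : lipGrowth f x ≤ lipGrowth f (f x) := by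
  have h1 : lipGrowth f x = limsup (fun n : ℕ =>
      ((1 / ((n + 1 : ℕ) : ℝ) * log⁺ (ptLip f^[n + 1] x) : ℝ) : EReal)) atTop :=
    (limsup_nat_add (fun n : ℕ => ((1 / (n : ℝ) * log⁺ (ptLip f^[n] x) : ℝ) : EReal)) 1).symm
  rw [h1]
  refine EReal.limsup_coe_le_of_le_add (w := fun n : ℕ => 1 / ((n : ℝ) + 1) * log⁺ (K : ℝ)) ?_ ?_
  · filter_upwards [eventually_gt_atTop 0] with n hn
    have hn' : (0 : ℝ) < n := by exact_mod_cast hn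
    have h2 : log⁺ (ptLip f^[n + 1] x) ≤ log⁺ (ptLip f^[n] (f x)) + log⁺ (K : ℝ) := by
      rw [Function.iterate_succ]
      exact (posLog_le_posLog (ptLip_nonneg _ _) (ptLip_comp_le (hf.iterate n) hf x)).trans
        posLog_mul
    have h3 : 1 / ((n : ℝ) + 1) ≤ 1 / n := one_div_le_one_div_of_le hn' (by linarith)
    have h4 : 0 ≤ log⁺ (ptLip f^[n] (f x)) := posLog_nonneg
    push_cast
    calc _ ≤ 1 / ((n : ℝ) + 1) * (log⁺ (ptLip f^[n] (f x)) + log⁺ (K : ℝ)) := by gcongr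
      _ = 1 / ((n : ℝ) + 1) * log⁺ (ptLip f^[n] (f x)) + 1 / ((n : ℝ) + 1) * log⁺ (K : ℝ) := by
        ring
      _ ≤ _ := by gcongr
  · simpa using (tendsto_one_div_add_atTop_nhds_zero_nat (𝕜 := ℝ)).mul_const (log⁺ (K : ℝ))

variable [MeasurableSpace X] [BorelSpace X]

lemma measurable_lipGrowth (hf : LipschitzWith K f) : Measurable (lipGrowth f) := by
  refine Measurable.limsup fun n => measurable_coe_real_ereal.comp ?_
  exact measurable_const.mul (continuous_posLog.measurable.comp
    (measurable_ptLip (hf.iterate n)))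

/-- The growth rate does not decrease along orbits, yet it has the same integral as its composition
with `f`. It is therefore invariant almost everywhere, and ergodicity makes it constant. -/
lemma exists_ae_lipGrowth_eq {μ : Measure X} [IsProbabilityMeasure μ] (hf : LipschitzWith K f)
    (herg : Ergodic f μ) : ∃ χ : ℝ, 0 ≤ χ ∧ ∀ᵐ x ∂μ, lipGrowth f x = χ := by
  set Λ : X → ℝ := fun x => (lipGrowth f x).toReal with hΛ
  have hm : Measurable Λ := measurable_ereal_toReal.comp (measurable_lipGrowth hf)
  have h0 : ∀ x, 0 ≤ Λ x := fun x => EReal.toReal_nonneg (lipGrowth_nonneg x)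
  have hK : ∀ x, Λ x ≤ log⁺ (K : ℝ) := fun x => by
    rw [← EReal.coe_le_coe_iff, lipGrowth_eq_coe_toReal hf]
    exact lipGrowth_le hf x
  have hle : ∀ x, Λ x ≤ Λ (f x) := fun x => by
    rw [← EReal.coe_le_coe_iff, lipGrowth_eq_coe_toReal hf, lipGrowth_eq_coe_toReal hf]
    exact lipGrowth_le_comp hf x
  have hi : Integrable Λ μ := Integrable.of_bound (C := log⁺ (K : ℝ)) hm.aestronglyMeasurable
    (Eventually.of_forall fun x => by rw [norm_of_nonneg (h0 x)]; exact hK x)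
  have hp := herg.toMeasurePreserving
  have hi' : Integrable (fun x => Λ (f x)) μ := hp.integrable_comp_of_integrable hi
  have hint : ∫ x, Λ (f x) ∂μ = ∫ x, Λ x ∂μ := by
    conv_rhs => rw [← hp.map_eq]
    rw [integral_map hp.aemeasurable hm.aestronglyMeasurable]
  have hae : Λ ∘ f =ᵐ[μ] Λ := by
    have h1 : ∫ x, (Λ (f x) - Λ x) ∂μ = 0 := by rw [integral_sub hi' hi, hint, sub_self]
    have h2 := (integral_eq_zero_iff_of_nonneg (fun x => sub_nonneg.2 (hle x)) (hi'.sub hi)).1 h1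
    filter_upwards [h2] with x hx
    exact sub_eq_zero.1 hx
  obtain ⟨χ, hχ⟩ := herg.ae_eq_const_of_ae_eq_comp₀ hm.nullMeasurable hae
  have hχ' : ∀ᵐ x ∂μ, lipGrowth f x = χ := by
    filter_upwards [hχ] with x hx
    rw [← lipGrowth_eq_coe_toReal hf x]
    exact congrArg _ hx
  obtain ⟨x, hx⟩ := hχ'.exists
  refine ⟨χ, ?_, hχ'⟩
  have := lipGrowth_nonneg (f := f) x
  rw [hx] at this
  exact_mod_cast this

omit [MeasurableSpace X] [BorelSpace X] in
lemma tendsto_of_lipGrowth_eq_zero {x : X} (h : lipGrowth f x = 0) :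
    Tendsto (fun n : ℕ => 1 / (n : ℝ) * log⁺ (ptLip f^[n] x)) atTop (𝓝 0) := by
  rw [← EReal.tendsto_coe]
  refine tendsto_of_le_liminf_of_limsup_le ?_ h.le
  exact le_liminf_of_le (h := Eventually.of_forall fun n => by
    exact_mod_cast inv_mul_posLog_ptLip_nonneg n x)

end LipGrowth

/-! ### From the growth rate to a Lyapunov exponent -/

section Main

open Real

variable {d : ℕ} {M : Type*} [MetricSpace M] [CompactSpace M]
  [ChartedSpace (EuclideanSpace ℝ (Fin d)) M] [IsManifold (𝓡 d) ∞ M]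

omit [CompactSpace M] [IsManifold (𝓡 d) ∞ M] in
lemma modelDeriv_comp_apply {V : Type*} [NormedAddCommGroup V] [NormedSpace ℝ V] {e : M → V}
    {F : M → M} (he : ContMDiff (𝓡 d) 𝓘(ℝ, V) 1 e) (hF : ContMDiff (𝓡 d) (𝓡 d) 1 F) (x : M)
    (v : TangentSpace (𝓡 d) x) :
    modelDeriv d (e ∘ F) x v = modelDeriv d e (F x) (mfderiv (𝓡 d) (𝓡 d) F x v) := by
  rw [modelDeriv, mfderiv_comp x (he.mdifferentiableAt one_ne_zero)
    (hF.mdifferentiableAt one_ne_zero)]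
  rfl

/-- Where the infinitesimal Lipschitz constants of the iterates grow at a positive rate, this rate
is the Lyapunov exponent of some tangent vector. -/
lemma exists_lyapunovExponent_eq
    (g : Bundle.ContinuousRiemannianMetric (EuclideanSpace ℝ (Fin d))
      (fun x : M => TangentSpace (𝓡 d) x)) {V : Type*} [NormedAddCommGroup V] [NormedSpace ℝ V]
    {e : M → V} (hiso : Isometry e) (he : ContMDiff (𝓡 d) 𝓘(ℝ, V) 1 e)
    (him : ∀ x, Function.Injective (modelDeriv d e x)) {f : M → M} {K : ℝ≥0}
    (hf : LipschitzWith K f) (hfs : ContMDiff (𝓡 d) (𝓡 d) 1 f) {x : M} {χ : ℝ} (hχ : 0 < χ)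
    (hx : lipGrowth f x = χ) :
    ∃ v : TangentSpace (𝓡 d) x, v ≠ 0 ∧ lyapunovExponent g f x v = χ := by
  have hfn : ∀ n : ℕ, ContMDiff (𝓡 d) (𝓡 d) 1 f^[n] := by
    intro n
    induction n with
    | zero => exact contMDiff_id
    | succ n ih => rw [Function.iterate_succ]; exact ih.comp hfs
  have hhomg : ∀ (x : M) (c : ℝ) (v : TangentSpace (𝓡 d) x), 0 ≤ c →
      √(g.inner x (c • v) (c • v)) = c * √(g.inner x v v) := by
    intro x c v hc
    simp only [map_smul, smul_apply, smul_eq_mul]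
    rw [← mul_assoc, sqrt_mul (by positivity), sqrt_mul_self hc]
  have hhome : ∀ (x : M) (c : ℝ) (v : TangentSpace (𝓡 d) x), 0 ≤ c →
      ‖modelDeriv d e x (c • v)‖ = c * ‖modelDeriv d e x v‖ := by
    intro x c v hc
    have := (modelDeriv d e x).map_smul c v
    refine (congrArg norm this).trans ?_
    rw [norm_smul, norm_of_nonneg hc]
  have hpose : ∀ (x : M) (v : TangentSpace (𝓡 d) x), v ≠ 0 → 0 < ‖modelDeriv d e x v‖ := by
    intro x v hv
    refine norm_pos_iff.2 fun h => hv (him x (h.trans (map_zero _).symm))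
  -- The constants must be uniform over `M`, since the two norms are compared at the moving point
  -- `f^[n] x`.
  obtain ⟨C₁, hC₁, hC₁'⟩ := exists_forall_le_mul_of_homogeneous
    (continuous_norm_modelDeriv he) (continuous_sqrt_inner g) hhome hhomg
    (fun x v hv => sqrt_pos.2 (g.pos x v hv))
  obtain ⟨C₂, hC₂, hC₂'⟩ := exists_forall_le_mul_of_homogeneous
    (continuous_sqrt_inner g) (continuous_norm_modelDeriv he) hhomg hhome hpose
  obtain ⟨κ, hκ, hκ'⟩ := exists_ptLip_le_sum_norm_modelDeriv hiso he (him x)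
  let b : Fin d → TangentSpace (𝓡 d) x := fun i => EuclideanSpace.single i (1 : ℝ)
  have hb : ∀ i, b i ≠ 0 := fun i h => by
    have : EuclideanSpace.single i (1 : ℝ) = 0 := h
    simp at this
  set a : Fin d → ℕ → ℝ := fun i n => √(g.inner (f^[n] x)
    (mfderiv (𝓡 d) (𝓡 d) f^[n] x (b i)) (mfderiv (𝓡 d) (𝓡 d) f^[n] x (b i))) with ha
  have ha0 : ∀ i n, 0 ≤ a i n := fun i n => sqrt_nonneg _
  have hlow : ∀ n, ptLip f^[n] x ≤ κ * ∑ i, C₁ * a i n := by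
    intro n
    refine (hκ' f^[n] _ (hf.iterate n) (hfn n)).trans ?_
    gcongr with i
    have := modelDeriv_comp_apply he (hfn n) x (b i)
    refine (congrArg norm this).le.trans ?_
    exact hC₁' _ _
  have hupp : ∀ i n, a i n ≤ ptLip f^[n] x * (C₂ * ‖modelDeriv d e x (b i)‖) := by
    intro i n
    have h1 := hC₂' (f^[n] x) (mfderiv (𝓡 d) (𝓡 d) f^[n] x (b i))
    have h2 := norm_modelDeriv_le_ptLip_mul hiso he (hfn n) (hf.iterate n) x (b i)
    rw [modelDeriv_comp_apply he (hfn n) x (b i)] at h2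
    calc a i n ≤ _ := h1
      _ ≤ C₂ * (ptLip f^[n] x * ‖modelDeriv d e x (b i)‖) := by gcongr
      _ = _ := by ring
  have hle : ∀ i, lyapunovExponent g f x (b i) ≤ χ := by
    intro i
    rw [← hx]
    refine EReal.limsup_coe_le_of_le_add
      (w := fun n : ℕ => 1 / (n : ℝ) * log⁺ (C₂ * ‖modelDeriv d e x (b i)‖))
      (Eventually.of_forall fun n => ?_) ?_
    · rw [← mul_add]
      refine mul_le_mul_of_nonneg_left ?_ (by positivity)
      calc log (a i n) ≤ log⁺ (a i n) := le_max_right _ _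
        _ ≤ log⁺ (ptLip f^[n] x * (C₂ * ‖modelDeriv d e x (b i)‖)) :=
          posLog_le_posLog (ha0 i n) (hupp i n)
        _ ≤ _ := posLog_mul
    · simpa using tendsto_one_div_atTop_nhds_zero_nat.mul_const
        (log⁺ (C₂ * ‖modelDeriv d e x (b i)‖))
  by_contra! hne
  have hlt : ∀ i, lyapunovExponent g f x (b i) < χ := fun i =>
    lt_of_le_of_ne (hle i) (hne (b i) (hb i))
  -- If every basis vector had exponent below `χ`, a common rate `χ' < χ` would bound them all, and
  -- hence `lipGrowth f x`. Joining with `0`, allowed because `0 < χ`, gives `0 ≤ χ'`, as `log⁺`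
  -- requires; it also covers `d = 0`, where the supremum is `⊥`.
  have hsup : Finset.univ.sup (fun i => lyapunovExponent g f x (b i)) ⊔ 0 < (χ : EReal) := by
    refine max_lt ?_ (by exact_mod_cast hχ)
    rw [Finset.sup_lt_iff (EReal.bot_lt_coe χ)]
    exact fun i _ => hlt i
  obtain ⟨χ', h1, h2⟩ := EReal.lt_iff_exists_real_btwn.1 hsup
  have hχ'0 : 0 ≤ χ' := by
    have := (le_max_right _ _).trans h1.le
    exact_mod_cast this
  have hev : ∀ᶠ n : ℕ in atTop, ∀ i, a i n ≤ exp (χ' * n) := by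
    rw [eventually_all]
    intro i
    have h3 : lyapunovExponent g f x (b i) < χ' :=
      ((Finset.le_sup (f := fun i => lyapunovExponent g f x (b i)) (Finset.mem_univ i)).trans
        (le_max_left _ _)).trans_lt h1
    filter_upwards [eventually_lt_of_limsup_lt h3, eventually_gt_atTop 0] with n hn hn0
    have hn' : (0 : ℝ) < n := by exact_mod_cast hn0
    have hn2 : 1 / (n : ℝ) * log (a i n) < χ' := by exact_mod_cast hn
    rw [one_div, inv_mul_lt_iff₀ hn'] at hn2
    -- A vanishing length is treated apart: `log 0 = 0` by convention, so the logarithmic bound says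
    -- nothing there.
    rcases (ha0 i n).eq_or_lt with h | h
    · rw [← h]; positivity
    · rw [← log_le_iff_le_exp h]
      linarith
  have hfin : lipGrowth f x ≤ limsup (fun _ : ℕ => ((χ' : ℝ) : EReal)) atTop := by
    refine EReal.limsup_coe_le_of_le_add
      (w := fun n : ℕ => 1 / (n : ℝ) * log⁺ (κ * (d * C₁))) ?_ ?_
    · filter_upwards [hev, eventually_gt_atTop 0] with n hn hn0
      have hn' : (0 : ℝ) < n := by exact_mod_cast hn0
      have h3 : ptLip f^[n] x ≤ κ * (d * C₁) * exp (χ' * n) := by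
        refine (hlow n).trans ?_
        calc κ * ∑ i, C₁ * a i n ≤ κ * ∑ i : Fin d, C₁ * exp (χ' * n) := by
              gcongr with i
              exact hn i
          _ = _ := by simp; ring
      have h4 : log⁺ (ptLip f^[n] x) ≤ log⁺ (κ * (d * C₁)) + χ' * n := by
        refine (posLog_le_posLog (ptLip_nonneg _ _) h3).trans (posLog_mul.trans ?_)
        rw [posLog_apply (x := exp _), log_exp, max_eq_right (by positivity)]
      calc 1 / (n : ℝ) * log⁺ (ptLip f^[n] x)
          ≤ 1 / (n : ℝ) * (log⁺ (κ * (d * C₁)) + χ' * n) := by gcongr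
        _ = _ := by field_simp; ring
    · simpa using tendsto_one_div_atTop_nhds_zero_nat.mul_const (log⁺ (κ * (d * C₁)))
  rw [hx, limsup_const] at hfin
  exact absurd h2 (not_lt.2 hfin)

theorem IsExponentiallyMixing.exists_lyapunovExponent_pos [MeasurableSpace M] [BorelSpace M]
    (g : Bundle.ContinuousRiemannianMetric (EuclideanSpace ℝ (Fin d))
      (fun x : M => TangentSpace (𝓡 d) x)) {q : ℕ} {e : M → EuclideanSpace ℝ (Fin q)}
    (hiso : Isometry e) (he : ContMDiff (𝓡 d) 𝓘(ℝ, EuclideanSpace ℝ (Fin q)) ∞ e)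
    (him : ∀ x, Function.Injective (modelDeriv d e x)) {f : M → M}
    (hfs : ContMDiff (𝓡 d) (𝓡 d) 1 f) (μ : Measure M) [IsProbabilityMeasure μ]
    (hna : ∀ x : M, μ {x} = 0) (hμ : MeasurePreserving f μ μ)
    (hmix : IsExponentiallyMixing d f μ) :
    ∃ χ : ℝ, 0 < χ ∧ ∀ᵐ x ∂μ, ∃ v : TangentSpace (𝓡 d) x, v ≠ 0 ∧
      lyapunovExponent g f x v = (χ : EReal) := by
  have he1 : ContMDiff (𝓡 d) 𝓘(ℝ, EuclideanSpace ℝ (Fin q)) 1 e :=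
    he.of_le (by exact_mod_cast le_top)
  obtain ⟨K, hf⟩ := exists_lipschitzWith_of_contMDiff hiso he1 hfs him
  obtain ⟨χ, hχ, hae⟩ := exists_ae_lipGrowth_eq hf (hmix.ergodic hμ)
  have hpos : 0 < χ := by
    refine hχ.lt_of_ne fun h0 => ?_
    obtain ⟨r, C, η, hη, H⟩ := hmix.measure_ball_mul_le hiso he
    refine not_ae_tendsto_of_correlation_decay hiso hna hf hμ hη H ?_
    filter_upwards [hae] with x hx
    exact tendsto_of_lipGrowth_eq_zero (by rw [hx, ← h0]; rfl)
  refine ⟨χ, hpos, ?_⟩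
  filter_upwards [hae] with x hx
  exact exists_lyapunovExponent_eq g hiso he1 him hf hfs hpos hx

end Main

end

theorem proposition1p3 {d : ℕ} {M : Type*} [TopologicalSpace M] [T2Space M] [CompactSpace M]
    [ChartedSpace (EuclideanSpace ℝ (Fin d)) M] [IsManifold (𝓡 d) ∞ M]
    [MeasurableSpace M] [BorelSpace M]
    (g : Bundle.ContinuousRiemannianMetric (EuclideanSpace ℝ (Fin d))
      (fun x : M => TangentSpace (𝓡 d) x))
    (α : ℝ≥0) (hα₀ : 0 < α) (hα₁ : α ≤ 1)
    (f : M ≃ₘ^1⟮𝓡 d, 𝓡 d⟯ M) (hf : HasHolderDerivative d α f)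
    (μ : Measure M) [IsProbabilityMeasure μ] (hna : ∀ x : M, μ {x} = 0) (hμ : MeasurePreserving f μ μ)
    (hmix : IsExponentiallyMixing d f μ) :
    ∃ χ : ℝ, 0 < χ ∧ ∀ᵐ x ∂μ, ∃ v : TangentSpace (𝓡 d) x, v ≠ 0 ∧
      lyapunovExponent g f x v = (χ : EReal) := by
  obtain ⟨q, e, he, hemb, him⟩ := exists_embedding_euclidean_of_compact (I := 𝓡 d) (M := M)
  -- The distance is pulled back from the Euclidean space, which makes `e` an isometry by definition
  -- while the topology of `M` is unchanged.
  let : MetricSpace M := hemb.isEmbedding.comapMetricSpace e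
  exact hmix.exists_lyapunovExponent_pos g (Isometry.of_dist_eq fun _ _ => rfl) he him
    f.contMDiff μ hna hμ
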